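/- Let $\mathcal M$ be a finite-dimensional smooth Riemannian manifold without boundary that is geodesically complete, so that $\mathrm{Exp}_x$ is defined on all of $T_x\mathcal M$ for every $x$. Let $\mathcal D$ be a probability distribution, let $f(\cdot,\xi):\mathcal M\to\mathbb R$ be functions indexed by the samples $\xi$, integrable in $\xi\sim\mathcal D$, and let $f(x)=\mathbb E_{\xi\sim\mathcal D}[f(x,\xi)]$ be differentiable; $\nabla$ denotes the Riemannian gradient in $x$. Assume: (i) (unbiasedness) $\mathbb E_{\xi\sim\mathcal D}[\nabla f(x,\xi)]=\nabla f(x)$ for all $x\in\mathcal M$; (ii) (bounded variance) for some $\sigma\ge 0$, $\mathbb E_{\xi\sim\mathcal D}\|\nabla f(x,\xi)-\nabla f(x)\|^2\le\sigma^2$ for all $x\in\mathcal M$; (iii) (geodesic $L$-smoothness, $L>0$) for every $\xi$, the function $f(\cdot,\xi)$ is differentiable and, for every geodesic $\gamma:[0,1]\to\mathcal M$ with $\gamma(0)=x$, $\gamma(1)=y$, $\|\nabla f(x,\xi)-\Gamma_y^x\nabla f(y,\xi)\|\le L\|\dot\gamma(0)\|$, where $\Gamma_y^x$ is the parallel transport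 (of the Levi-Civita connection) along $\gamma$ from $y$ to $x$; (iv) (lower bound) $f^*\in\mathbb R$ satisfies $f(x)\ge f^*$ for all $x\in\mathcal M$. For a batch of $n$ independent samples $\xi_1,\dots,\xi_n\sim\mathcal D$ write $\nabla f_n(x)=\frac1n\sum_{i=1}^n\nabla f(x,\xi_i)$. Given $x^0\in\mathcal M$, a stepsize $\eta>0$, batch sizes $B,b\ge 1$ and $p\in(0,1]$, R-PAGE sets $g^0=\nabla f_B(x^0)$ and, for $k=0,1,2,\dots$, $x^{k+1}=\mathrm{Exp}_{x^k}(-\eta g^k)$ and $$g^{k+1}=\begin{cases}\nabla f_B(x^{k+1}) & \text{with probability } p,\\ \Gamma_{x^k}^{x^{k+1}}g^k+\nabla f_b(x^{k+1})-\Gamma_{x^k}^{x^{k+1}}\nabla f_b(x^k) & \text{with probability } 1-p,\end{cases}$$ where $\Gamma_{x^k}^{x^{k+1}}$ is the parallel transport along the geodesic $t\mapsto\mathrm{Exp}_{x^k}(-t\eta g^k)$, $0\le t\le1$, the two gradients $\nabla f_b$ use the same batch, and the batches and coins of all the iterations are drawn afresh and independently. If $$\eta\le\frac{1}{L\left(1+\sqrt{\frac{1-p}{pb}}\right)},$$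 then for every $K\ge 1$ $$\mathbb E\|\nabla f(\widehat x^K)\|^2\le\frac{2\,\mathbb E[\Phi^0]}{\eta K}+\frac{\sigma^2}{B},\qquad \Phi^0=f(x^0)-f^*+\frac{\eta\sigma^2}{2pB},$$ where $\widehat x^K$ is chosen uniformly at random from $x^0,\dots,x^{K-1}$, independently of everything else. (As $x^0$ is deterministic, $\mathbb E[\Phi^0]=\Phi^0$.) -/

import Mathlib

open MeasureTheory ProbabilityTheory Bundle
open scoped Manifold ContDiff

noncomputable section

namespace RPage

section Geometry

variable {E : Type*} [NormedAddCommGroup E] [NormedSpace ℝ E]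
  {M : Type*} [TopologicalSpace M] [ChartedSpace E M] [IsManifold 𝓘(ℝ, E) ∞ M]

/-- The velocity `γ'(t) ∈ T_{γ(t)} M` of a curve in `M`. -/
def velocity (γ : ℝ → M) (t : ℝ) : TangentSpace 𝓘(ℝ, E) (γ t) :=
  mfderiv 𝓘(ℝ, ℝ) 𝓘(ℝ, E) γ t (1 : ℝ)

/-- The coordinate vector field (constant in the preferred chart at `x`, defined near `x`) that
takes the value `v` at `x`. -/
def coordField (x : M) (v : TangentSpace 𝓘(ℝ, E) x) (p : M) : TangentSpace 𝓘(ℝ, E) p :=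
  (trivializationAt E (TangentSpace 𝓘(ℝ, E)) x).symm p
    (trivializationAt E (TangentSpace 𝓘(ℝ, E)) x ⟨x, v⟩).2

/-- The components, in the preferred chart at `γ t₀`, of a vector field `V` along `γ`. -/
def coordAlong (γ : ℝ → M) (V : ∀ t, TangentSpace 𝓘(ℝ, E) (γ t)) (t₀ t : ℝ) : E :=
  (trivializationAt E (TangentSpace 𝓘(ℝ, E)) (γ t₀) ⟨γ t, V t⟩).2

variable [RiemannianBundle (fun x : M ↦ TangentSpace 𝓘(ℝ, E) x)]

/-- The derivative at `x`, in the direction `u`, of the metric coefficient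
`p ↦ ⟨v, w⟩_p` of the preferred chart at `x`. -/
def metricDeriv (x : M) (u v w : TangentSpace 𝓘(ℝ, E) x) : ℝ :=
  mfderiv 𝓘(ℝ, E) 𝓘(ℝ, ℝ)
    (fun p : M ↦ (inner ℝ (coordField x v p) (coordField x w p) : ℝ)) x u

/-- Christoffel symbols of the first kind of the Levi-Civita connection, in the preferred chart at
`x` and at the point `x`: the number `⟨∇_u v, w⟩` for coordinate fields, given by
`(∂_u g(v, w) + ∂_v g(u, w) - ∂_w g(u, v)) / 2`. -/
def christoffel (x : M) (u v w : TangentSpace 𝓘(ℝ, E) x) : ℝ :=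
  (metricDeriv x u v w + metricDeriv x v u w - metricDeriv x w u v) / 2

/-- `V` is parallel along `γ` for the Levi-Civita connection: at each time `t`, in the chart at
`γ t`, the covariant derivative `V' + Γ(γ', V)` vanishes (tested against every vector `w`). -/
def IsParallelAlong (γ : ℝ → M) (V : ∀ t, TangentSpace 𝓘(ℝ, E) (γ t)) : Prop :=
  ∀ t : ℝ, DifferentiableAt ℝ (coordAlong γ V t) t ∧
    ∀ w : TangentSpace 𝓘(ℝ, E) (γ t),
      inner ℝ ((trivializationAt E (TangentSpace 𝓘(ℝ, E)) (γ t)).symm (γ t)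
          (deriv (coordAlong γ V t) t)) w
        + christoffel (γ t) (velocity γ t) (V t) w = 0

/-- A geodesic `ℝ → M`: a smooth curve whose velocity is parallel along it. -/
def IsGeodesic (γ : ℝ → M) : Prop :=
  ContMDiff 𝓘(ℝ, ℝ) 𝓘(ℝ, E) ∞ γ ∧ IsParallelAlong γ (velocity (E := E) γ)

/-- `γ` is a geodesic with `γ(0) = x` and `γ'(0) = v`. -/
def IsGeodesicFrom (x : M) (v : TangentSpace 𝓘(ℝ, E) x) (γ : ℝ → M) : Prop :=
  IsGeodesic (E := E) γ ∧ (⟨γ 0, velocity γ 0⟩ : TangentBundle 𝓘(ℝ, E) M) = ⟨x, v⟩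

variable (E M) in
/-- Geodesic completeness: the exponential map is defined on the whole tangent bundle. -/
def GeodesicallyComplete : Prop :=
  ∀ (x : M) (v : TangentSpace 𝓘(ℝ, E) x), ∃ γ : ℝ → M, IsGeodesicFrom x v γ

open Classical in
/-- The geodesic with initial point `x` and initial velocity `v`
(a junk value if there is none). -/
def geodesic (x : M) (v : TangentSpace 𝓘(ℝ, E) x) : ℝ → M :=
  if h : ∃ γ : ℝ → M, IsGeodesicFrom x v γ then h.choose else fun _ ↦ x

/-- The exponential map `Exp_x(v)`. -/
def expMap (x : M) (v : TangentSpace 𝓘(ℝ, E) x) : M := geodesic x v 1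

/-- The tangent vector `w` is the parallel transport of `u` along `γ` from time `a` to time `b`. -/
def IsParallelTransport (γ : ℝ → M) (a b : ℝ) (u w : TangentBundle 𝓘(ℝ, E) M) : Prop :=
  ∃ V : ∀ t, TangentSpace 𝓘(ℝ, E) (γ t), IsParallelAlong γ V ∧
    (⟨γ a, V a⟩ : TangentBundle 𝓘(ℝ, E) M) = u ∧ (⟨γ b, V b⟩ : TangentBundle 𝓘(ℝ, E) M) = w

open Classical in
/-- The parallel transport `Γ_x^y u ∈ T_y M` of `u ∈ T_x M` to `y = Exp_x(v)`, along the geodesic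
`t ↦ Exp_x(t v)`, `0 ≤ t ≤ 1`. -/
def expTransport (x : M) (v u : TangentSpace 𝓘(ℝ, E) x) : TangentSpace 𝓘(ℝ, E) (expMap x v) :=
  if h : ∃ w : TangentSpace 𝓘(ℝ, E) (expMap x v),
      IsParallelTransport (geodesic x v) 0 1 ⟨x, u⟩ ⟨expMap x v, w⟩
  then h.choose else 0

variable [FiniteDimensional ℝ E]

/-- The Riemannian gradient: `⟨∇f(x), v⟩ = df_x(v)` for all `v ∈ T_x M`. -/
def grad (f : M → ℝ) (x : M) : TangentSpace 𝓘(ℝ, E) x :=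
  haveI : FiniteDimensional ℝ (TangentSpace 𝓘(ℝ, E) x) := inferInstanceAs (FiniteDimensional ℝ E)
  haveI : CompleteSpace (TangentSpace 𝓘(ℝ, E) x) := FiniteDimensional.complete ℝ _
  (InnerProductSpace.toDual ℝ (TangentSpace 𝓘(ℝ, E) x)).symm (mfderiv 𝓘(ℝ, E) 𝓘(ℝ, ℝ) f x)

variable (E) in
/-- Geodesic `L`-smoothness: `f` is differentiable and `‖∇f(x) - Γ_y^x ∇f(y)‖ ≤ L ‖v‖` for every
geodesic `γ : [0, 1] → M` from `x` to `y` with initial velocity `v`, where `Γ_y^x` is the parallel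
transport along `γ`. -/
def GeodesicallySmooth (L : ℝ) (f : M → ℝ) : Prop :=
  MDifferentiable 𝓘(ℝ, E) 𝓘(ℝ, ℝ) f ∧
    ∀ γ : ℝ → M, IsGeodesic (E := E) γ → ∀ w : TangentSpace 𝓘(ℝ, E) (γ 0),
      IsParallelTransport γ 1 0 ⟨γ 1, grad f (γ 1)⟩ ⟨γ 0, w⟩ →
        ‖grad f (γ 0) - w‖ ≤ L * ‖velocity (E := E) γ 0‖

end Geometry

section Algorithm

/-- The fresh randomness of one iteration: a batch of size `B`, a batch of size `b`, a coin. -/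
abbrev Sample (Ξ : Type*) (B b : ℕ) : Type _ := (Fin B → Ξ) × (Fin b → Ξ) × Bool

/-- The law of a sample: i.i.d. draws from `D`, and an independent coin that
shows `true` with probability `p`. -/
def sampleLaw {Ξ : Type*} [MeasurableSpace Ξ] (D : Measure Ξ) (B b : ℕ)
    (p : unitInterval) : Measure (Sample Ξ B b) :=
  (Measure.pi fun _ : Fin B ↦ D).prod ((Measure.pi fun _ : Fin b ↦ D).prod (bernoulliMeasure true false p))

/-- The objective of the online problem, `f(x) = 𝔼_{ξ ∼ D} f(x, ξ)`. -/
def objective {M Ξ : Type*} [MeasurableSpace Ξ] (D : Measure Ξ) (F : M → Ξ → ℝ) (x : M) : ℝ :=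
  ∫ ξ, F x ξ ∂D

variable {E : Type*} [NormedAddCommGroup E] [NormedSpace ℝ E] [FiniteDimensional ℝ E]
  {M : Type*} [TopologicalSpace M] [ChartedSpace E M] [IsManifold 𝓘(ℝ, E) ∞ M]
  [RiemannianBundle (fun x : M ↦ TangentSpace 𝓘(ℝ, E) x)]
  {Ξ : Type*}

/-- The stochastic gradient `∇f(x, ξ)`, the gradient being taken in `x`. -/
def stochGrad (F : M → Ξ → ℝ) (x : M) (ξ : Ξ) : TangentSpace 𝓘(ℝ, E) x :=
  grad (fun y ↦ F y ξ) x

/-- The minibatch gradient `(1/n) ∑ᵢ ∇f(x, ξᵢ)`. -/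
def batchGrad (F : M → Ξ → ℝ) {n : ℕ} (ξ : Fin n → Ξ) (x : M) : TangentSpace 𝓘(ℝ, E) x :=
  (1 / n : ℝ) • ∑ i, stochGrad F x (ξ i)

/-- One iteration of R-PAGE, from `(xᵏ, gᵏ)` to `(xᵏ⁺¹, gᵏ⁺¹)`. -/
def pageStep (F : M → Ξ → ℝ) (η : ℝ) {B b : ℕ} (z : TangentBundle 𝓘(ℝ, E) M)
    (s : Sample Ξ B b) : TangentBundle 𝓘(ℝ, E) M :=
  let x : M := z.1
  let g : TangentSpace 𝓘(ℝ, E) x := z.2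
  let v : TangentSpace 𝓘(ℝ, E) x := -(η • g)
  let y : M := expMap x v
  if s.2.2 then ⟨y, batchGrad F s.1 y⟩
  else ⟨y, expTransport x v g + batchGrad F s.2.1 y - expTransport x v (batchGrad F s.2.1 x)⟩

variable (E) in
/-- The pair `(xᵏ, gᵏ)` of R-PAGE started at `x₀` with step size `η`, as a function of the samples:
`g⁰` is the batch gradient of sample `0`, and step `k → k + 1` uses sample `k + 1`. -/
def pageState (F : M → Ξ → ℝ) (η : ℝ) (x₀ : M) {B b : ℕ} (s : ℕ → Sample Ξ B b) :
    ℕ → TangentBundle 𝓘(ℝ, E) M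
  | 0 => ⟨x₀, batchGrad F (s 0).1 x₀⟩
  | k + 1 => pageStep F η (pageState F η x₀ s k) (s (k + 1))

end Algorithm

end RPage

end

noncomputable section

namespace RPage

/-! The argument is the Euclidean PAGE analysis, once parallel transport is known to be a linear
isometry. Write $e_k=\|g^k-\nabla f(x^k)\|^2$.

Descent. The objective inherits geodesic smoothness from the samples, because transport commutes
with the expectation. It therefore lies below its quadratic model along the step, which gives
(`objective_pageStep_le`) $f(x^{k+1})\le f(x^k)-\frac\eta2\|\nabla
f(x^k)\|^2-\frac\eta2(1-L\eta)\|g^k\|^2+\frac\eta2 e_k$.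

Error recursion. With probability $p$ the error is refreshed and has mean at most $\sigma^2/B$.
Otherwise the new error vector is the transported old one plus a centred average of $b$ independent
terms, each of second moment at most $L^2\eta^2\|g^k\|^2$. The cross terms vanish, so
(`lintegral_gradError_pageStep_le`) $\mathbb E e_{k+1}\le p\sigma^2/B+(1-p)(\mathbb E
e_k+L^2\eta^2\,\mathbb E\|g^k\|^2/b)$.

Potential. In $f(x^k)-f^*+\frac{\eta}{2p}e_k$ the weight $\frac{\eta}{2p}$ makes the $e_k$ terms
cancel, and the bound on the stepsize makes the coefficient of $\|g^k\|^2$ nonpositive. Each step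
then costs only $\frac{\eta\sigma^2}{2B}$; telescoping and dividing by $\eta K/2$ gives the claim
(`sum_integral_le_of_descent`).

The geometry rests on `isParallelAt_iff`, which writes the transport equation in a fixed chart. From
it follow preservation of inner products, uniqueness, and global existence by gluing local solutions
of a linear ODE (`exists_linearIsometryEquiv_transport`). On the probabilistic side, conditioning on
the past is replaced by resampling one coordinate of the i.i.d. sequence
(`map_update_infinitePi_prod`). -/

/-- A shortcut for instance search. -/
instance addCommGroupBilinear {F : Type*} [NormedAddCommGroup F] [NormedSpace ℝ F] :
    AddCommGroup (F →L[ℝ] F →L[ℝ] ℝ) := ContinuousLinearMap.addCommGroup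

/-- A shortcut for instance search. -/
instance normedAddCommGroupBilinear {F : Type*} [NormedAddCommGroup F] [NormedSpace ℝ F] :
    NormedAddCommGroup (F →L[ℝ] F →L[ℝ] ℝ) := ContinuousLinearMap.toNormedAddCommGroup

/-- A shortcut for instance search. -/
instance normedSpaceBilinear {F : Type*} [NormedAddCommGroup F] [NormedSpace ℝ F] :
    NormedSpace ℝ (F →L[ℝ] F →L[ℝ] ℝ) := ContinuousLinearMap.toNormedSpace

/-! ### Local solvability of linear differential equations -/

section LinearODE

open Set Metric Topology

/-- A linear ordinary differential equation with continuous coefficients is solvable near `t₀`, on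
an interval that does not depend on the initial condition. -/
theorem exists_forall_hasDerivAt_linear {E : Type*} [NormedAddCommGroup E] [NormedSpace ℝ E]
    [CompleteSpace E] {A : ℝ → E →L[ℝ] E} {t₀ : ℝ} (hA : ∀ᶠ t in 𝓝 t₀, ContinuousAt A t) :
    ∃ ε > 0, ∀ s ∈ Ioo (t₀ - ε) (t₀ + ε), ∀ u : E, ∃ V : ℝ → E, V s = u ∧
      ∀ t ∈ Ioo (t₀ - ε) (t₀ + ε), HasDerivAt V (A t (V t)) t := by
  have hbd : ∀ᶠ t in 𝓝 t₀, ‖A t‖ < ‖A t₀‖ + 1 :=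
    hA.self_of_nhds.norm.eventually_lt_const (lt_add_one _)
  obtain ⟨δ, hδ, hball⟩ := Metric.eventually_nhds_iff.1 (hA.and hbd)
  set C : ℝ := ‖A t₀‖ + 1 with hC
  have hC0 : 0 < C := by positivity
  -- Picard–Lindelöf on the ball of radius $a=\|u\|+1$ about $u$: there $\|x\|\le 2a$, so the speed
  -- is at most $2aC$, and during a time at most $2\varepsilon$ the displacement is at most
  -- $2aC\cdot2\varepsilon\le a$. Both sides scale with $a$, so $\varepsilon$ does not depend on
  -- $u$.
  set ε : ℝ := min (δ / 2) (1 / (4 * C)) with hε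
  have hε0 : 0 < ε := by positivity
  have hεδ : ε < δ := (min_le_left _ _).trans_lt (by linarith)
  have hεC : C * (2 * ε) ≤ 1 / 2 := by
    have : ε ≤ 1 / (4 * C) := min_le_right _ _
    calc C * (2 * ε) ≤ C * (2 * (1 / (4 * C))) := by gcongr
      _ = 1 / 2 := by field_simp; norm_num
  have hin : ∀ t ∈ Icc (t₀ - ε) (t₀ + ε), ContinuousAt A t ∧ ‖A t‖ ≤ C := by
    intro t ht
    have h := hball (y := t) (by
      rw [Real.dist_eq, abs_lt]; constructor <;> linarith [ht.1, ht.2])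
    exact ⟨h.1, h.2.le⟩
  refine ⟨ε, hε0, fun s hs u ↦ ?_⟩
  let s' : Icc (t₀ - ε) (t₀ + ε) := ⟨s, Ioo_subset_Icc_self hs⟩
  let a : NNReal := ⟨‖u‖ + 1, by positivity⟩
  let C' : NNReal := ⟨C, hC0.le⟩
  have hpl : IsPicardLindelof (fun t x ↦ A t x) s' u a 0 (C' * (2 * a)) C' := by
    refine ⟨fun t ht ↦ ?_, fun x _ t ht ↦ ?_, fun t ht x hx ↦ ?_, ?_⟩
    · refine (LipschitzWith.weaken (A t).lipschitz ?_).lipschitzOnWith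
      exact (hin t ht).2
    · exact ((hin t ht).1.clm_apply continuousAt_const).continuousWithinAt
    · have hx' : ‖x‖ ≤ 2 * (‖u‖ + 1) := by
        have : ‖x - u‖ ≤ ‖u‖ + 1 := by
          rw [← dist_eq_norm]; exact hx
        have := norm_le_norm_add_norm_sub' x u
        linarith
      calc ‖A t x‖ ≤ ‖A t‖ * ‖x‖ := (A t).le_opNorm x
        _ ≤ C * (2 * (‖u‖ + 1)) := by
          gcongr
          exact (hin t ht).2
    · have h1 : max (t₀ + ε - s) (s - (t₀ - ε)) ≤ 2 * ε :=
        max_le (by linarith [hs.1]) (by linarith [hs.2])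
      have ha : (0 : ℝ) < ‖u‖ + 1 := by positivity
      change C * (2 * (‖u‖ + 1)) * max (t₀ + ε - s) (s - (t₀ - ε)) ≤ (‖u‖ + 1) - 0
      calc C * (2 * (‖u‖ + 1)) * max (t₀ + ε - s) (s - (t₀ - ε))
          ≤ C * (2 * (‖u‖ + 1)) * (2 * ε) := by gcongr
        _ = 2 * (‖u‖ + 1) * (C * (2 * ε)) := by ring
        _ ≤ 2 * (‖u‖ + 1) * (1 / 2) := by gcongr
        _ = (‖u‖ + 1) - 0 := by ring
  obtain ⟨V, hV, hV'⟩ := hpl.exists_eq_forall_mem_Icc_hasDerivWithinAt₀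
  refine ⟨V, hV, fun t ht ↦ ?_⟩
  exact (hV' t (Ioo_subset_Icc_self ht)).hasDerivAt (Icc_mem_nhds ht.1 ht.2)

end LinearODE

/-! ### Tangent coordinates and the metric in a chart -/

section Charts

open Set Topology Filter

variable {E : Type*} [NormedAddCommGroup E] [NormedSpace ℝ E]
  {M : Type*} [TopologicalSpace M] [ChartedSpace E M] [IsManifold 𝓘(ℝ, E) ∞ M]

/-- The coordinates, in the preferred chart at `z`, of a tangent vector at `q`. -/
def toCoord (z q : M) : TangentSpace 𝓘(ℝ, E) q →L[ℝ] E :=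
  (trivializationAt E (TangentSpace 𝓘(ℝ, E)) z).continuousLinearMapAt ℝ q

/-- The tangent vector at `q` with given coordinates in the preferred chart at `z`. -/
def ofCoord (z q : M) : E →L[ℝ] TangentSpace 𝓘(ℝ, E) q :=
  (trivializationAt E (TangentSpace 𝓘(ℝ, E)) z).symmL ℝ q

variable {z q p : M}

theorem ofCoord_toCoord (hq : q ∈ (chartAt E z).source) (v : TangentSpace 𝓘(ℝ, E) q) :
    ofCoord z q (toCoord z q v) = v :=
  (trivializationAt E (TangentSpace 𝓘(ℝ, E)) z).symmL_continuousLinearMapAt hq v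

theorem toCoord_ofCoord (hq : q ∈ (chartAt E z).source) (a : E) :
    toCoord z q (ofCoord z q a) = a :=
  (trivializationAt E (TangentSpace 𝓘(ℝ, E)) z).continuousLinearMapAt_symmL hq a

theorem toCoord_apply (hq : q ∈ (chartAt E z).source) (v : TangentSpace 𝓘(ℝ, E) q) :
    (trivializationAt E (TangentSpace 𝓘(ℝ, E)) z ⟨q, v⟩).2 = toCoord z q v :=
  ((trivializationAt E (TangentSpace 𝓘(ℝ, E)) z).continuousLinearMapAt_apply_of_mem ℝ hq v).symm

theorem ofCoord_apply (hq : q ∈ (chartAt E z).source) (a : E) :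
    (trivializationAt E (TangentSpace 𝓘(ℝ, E)) z).symm q a = ofCoord z q a :=
  ((trivializationAt E (TangentSpace 𝓘(ℝ, E)) z).symmL_apply hq a).symm

theorem coordField_eq (hq : q ∈ (chartAt E z).source) (v : TangentSpace 𝓘(ℝ, E) z) :
    coordField z v q = ofCoord z q (toCoord z z v) := by
  rw [coordField, toCoord_apply (mem_chart_source E z), ofCoord_apply hq]

/-- Links the bundle trivialization to calculus: its fibre coordinates are the derivative of the
chart, so changes of tangent coordinates become derivatives of transition maps. -/
theorem hasMFDerivAt_extChartAt_toCoord (hq : q ∈ (chartAt E z).source) :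
    HasMFDerivAt 𝓘(ℝ, E) 𝓘(ℝ, E) (extChartAt 𝓘(ℝ, E) z) q (toCoord z q) := by
  have h : MDifferentiableAt 𝓘(ℝ, E) 𝓘(ℝ, E) (extChartAt 𝓘(ℝ, E) z) q :=
    mdifferentiableAt_extChartAt hq
  have := h.hasMFDerivAt
  rw [← TangentBundle.continuousLinearMapAt_trivializationAt hq] at this
  exact this

/-- The transition map from the chart at `z` to the chart at `p`. -/
def transition (z p : M) : E → E :=
  extChartAt 𝓘(ℝ, E) p ∘ (extChartAt 𝓘(ℝ, E) z).symm

theorem contDiffAt_transition (hz : q ∈ (chartAt E z).source) (hp : q ∈ (chartAt E p).source) :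
    ContDiffAt ℝ ∞ (transition z p) (extChartAt 𝓘(ℝ, E) z q) := by
  have h := 𝓘(ℝ, E).contDiffWithinAt_extendCoordChange' (n := ∞) (x := q)
    (IsManifold.chart_mem_maximalAtlas z) (IsManifold.chart_mem_maximalAtlas p) hz hp
  rw [𝓘(ℝ, E).range_eq_univ, contDiffWithinAt_univ] at h
  exact h

theorem fderiv_transition_toCoord (hz : q ∈ (chartAt E z).source)
    (hp : q ∈ (chartAt E p).source) (v : TangentSpace 𝓘(ℝ, E) q) :
    fderiv ℝ (transition z p) (extChartAt 𝓘(ℝ, E) z q) (toCoord z q v) = toCoord p q v := by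
  have h1 := ((contDiffAt_transition hz hp).differentiableAt (by simp)).hasFDerivAt.hasMFDerivAt
  have h2 := h1.comp q (hasMFDerivAt_extChartAt_toCoord hz)
  have h3 : transition z p ∘ extChartAt 𝓘(ℝ, E) z =ᶠ[𝓝 q] extChartAt 𝓘(ℝ, E) p := by
    filter_upwards [(chartAt E z).open_source.mem_nhds hz] with x hx
    simp only [transition, Function.comp_apply]
    rw [(extChartAt 𝓘(ℝ, E) z).left_inv (by rwa [extChartAt_source])]
  have h4 := h2.congr_of_eventuallyEq h3.symm
  have h5 := hasMFDerivAt_unique h4 (hasMFDerivAt_extChartAt_toCoord hp)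
  exact DFunLike.congr_fun h5 v

variable [RiemannianBundle (fun x : M ↦ TangentSpace 𝓘(ℝ, E) x)]

/-- The Riemannian metric in the preferred chart at `z`, as a function on the model space. -/
def chartMetric (z : M) (y : E) : E →L[ℝ] E →L[ℝ] ℝ :=
  (innerSL ℝ (E := TangentSpace 𝓘(ℝ, E) ((extChartAt 𝓘(ℝ, E) z).symm y))).bilinearComp
    (ofCoord z ((extChartAt 𝓘(ℝ, E) z).symm y)) (ofCoord z ((extChartAt 𝓘(ℝ, E) z).symm y))

theorem chartMetric_symm_apply (z : M) (y a b : E) :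
    chartMetric z y a b = inner ℝ (ofCoord z ((extChartAt 𝓘(ℝ, E) z).symm y) a)
      (ofCoord z ((extChartAt 𝓘(ℝ, E) z).symm y) b) := rfl

theorem chartMetric_apply (hq : q ∈ (chartAt E z).source) (a b : E) :
    chartMetric z (extChartAt 𝓘(ℝ, E) z q) a b = inner ℝ (ofCoord z q a) (ofCoord z q b) := by
  rw [chartMetric_symm_apply, (extChartAt 𝓘(ℝ, E) z).left_inv (by rwa [extChartAt_source])]

theorem chartMetric_comm (z : M) (y a b : E) : chartMetric z y a b = chartMetric z y b a := by
  rw [chartMetric_symm_apply, chartMetric_symm_apply, real_inner_comm]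

theorem eq_zero_of_chartMetric (hq : q ∈ (chartAt E z).source) {a : E}
    (h : chartMetric z (extChartAt 𝓘(ℝ, E) z q) a a = 0) : a = 0 := by
  rw [chartMetric_apply hq, inner_self_eq_zero] at h
  rw [← toCoord_ofCoord hq a, h, map_zero]

variable [IsContMDiffRiemannianBundle 𝓘(ℝ, E) ∞ E (fun x : M ↦ TangentSpace 𝓘(ℝ, E) x)]

/-- The coordinate frame has constant components in its own trivialization, hence is smooth, and a
smooth bundle metric pairs smooth sections smoothly. -/
theorem contMDiffOn_inner_ofCoord (z : M) (a b : E) :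
    ContMDiffOn 𝓘(ℝ, E) 𝓘(ℝ, ℝ) ∞
      (fun q : M ↦ (inner ℝ (ofCoord z q a) (ofCoord z q b) : ℝ)) (chartAt E z).source := by
  have h : ∀ a : E, ContMDiffOn 𝓘(ℝ, E) (𝓘(ℝ, E).prod 𝓘(ℝ, E)) ∞
      (fun q : M ↦ (⟨q, ofCoord z q a⟩ : TotalSpace E (fun x : M ↦ TangentSpace 𝓘(ℝ, E) x)))
      (chartAt E z).source := by
    intro a q hq
    apply ContMDiffAt.contMDiffWithinAt
    refine ((trivializationAt E (TangentSpace 𝓘(ℝ, E)) z).contMDiffAt_section_iff hq).2 ?_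
    refine (contMDiffAt_const (c := a)).congr_of_eventuallyEq ?_
    filter_upwards [(chartAt E z).open_source.mem_nhds hq] with x hx
    rw [toCoord_apply hx, toCoord_ofCoord hx]
  exact ContMDiffOn.inner_bundle (F := E) (E := fun x : M ↦ TangentSpace 𝓘(ℝ, E) x)
    (b := fun q ↦ q) (v := fun q ↦ ofCoord z q a) (w := fun q ↦ ofCoord z q b) (h a) (h b)

variable [FiniteDimensional ℝ E]

theorem contDiffOn_chartMetric (z : M) :
    ContDiffOn ℝ ∞ (chartMetric (E := E) z) (extChartAt 𝓘(ℝ, E) z).target := by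
  refine contDiffOn_clm_apply.2 fun a ↦ contDiffOn_clm_apply.2 fun b ↦ ?_
  rw [← contMDiffOn_iff_contDiffOn]
  refine (contMDiffOn_inner_ofCoord z a b).comp (contMDiffOn_extChartAt_symm z) ?_
  intro y hy
  have := (extChartAt 𝓘(ℝ, E) z).map_target hy
  rwa [extChartAt_source] at this

theorem contDiffAt_chartMetric (hq : q ∈ (chartAt E z).source) :
    ContDiffAt ℝ ∞ (chartMetric (E := E) z) (extChartAt 𝓘(ℝ, E) z q) :=
  (contDiffOn_chartMetric z).contDiffAt (extChartAt_target_mem_nhds'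
    ((extChartAt 𝓘(ℝ, E) z).map_source (by rwa [extChartAt_source])))

/-- Christoffel symbols of the first kind of a metric `g` on the model space. -/
def christoffelOf (g : E → E →L[ℝ] E →L[ℝ] ℝ) (y u v w : E) : ℝ :=
  (fderiv ℝ g y u v w + fderiv ℝ g y v u w - fderiv ℝ g y w u v) / 2

end Charts

/-! ### Transformation of Christoffel symbols under a change of chart -/

section ChangeOfChart

open Set Topology Filter

variable {E : Type*} [NormedAddCommGroup E] [NormedSpace ℝ E]
  {M : Type*} [TopologicalSpace M] [ChartedSpace E M] [IsManifold 𝓘(ℝ, E) ∞ M]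
  {z p : M}

theorem transition_extChartAt {E M : Type*} [NormedAddCommGroup E] [NormedSpace ℝ E]
    [TopologicalSpace M] [ChartedSpace E M] {z p q : M} (hq : q ∈ (chartAt E z).source) :
    transition z p (extChartAt 𝓘(ℝ, E) z q) = extChartAt 𝓘(ℝ, E) p q := by
  simp only [transition, Function.comp_apply]
  rw [(extChartAt 𝓘(ℝ, E) z).left_inv (by rwa [extChartAt_source])]

/-- The first order behaviour at `p` of the change of coordinates of tangent vectors, between the
charts at `z` and at `p`: the derivative `T'` of `T` is symmetric since `T` is the derivative of the
transition map. -/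
theorem exists_hasFDerivAt_transition (hp : p ∈ (chartAt E z).source) :
    ∃ (T S : E → E →L[ℝ] E) (T' S' : E →L[ℝ] E →L[ℝ] E),
      HasFDerivAt T T' (extChartAt 𝓘(ℝ, E) z p) ∧ HasFDerivAt S S' (extChartAt 𝓘(ℝ, E) z p) ∧
      (∀ u v, T' u v = T' v u) ∧
      (∀ v, S (extChartAt 𝓘(ℝ, E) z p) (T (extChartAt 𝓘(ℝ, E) z p) v) = v) ∧
      (∀ u v, S' u (T (extChartAt 𝓘(ℝ, E) z p) v) = -S (extChartAt 𝓘(ℝ, E) z p) (T' u v)) ∧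
      ∀ᶠ q in 𝓝 p, q ∈ (chartAt E z).source ∧ q ∈ (chartAt E p).source ∧
        (∀ v : TangentSpace 𝓘(ℝ, E) q,
          toCoord p q v = T (extChartAt 𝓘(ℝ, E) z q) (toCoord z q v)) ∧
        (∀ v : TangentSpace 𝓘(ℝ, E) q,
          toCoord z q v = S (extChartAt 𝓘(ℝ, E) z q) (toCoord p q v)) ∧
        ∀ a, ofCoord p q a = ofCoord z q (S (extChartAt 𝓘(ℝ, E) z q) a) := by
  set y := extChartAt 𝓘(ℝ, E) z p with hy
  have hpp := mem_chart_source E p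
  have hzp := contDiffAt_transition hp hpp
  have hpz := contDiffAt_transition hpp hp
  let T : E → E →L[ℝ] E := fderiv ℝ (transition z p)
  let S : E → E →L[ℝ] E := fun x ↦ fderiv ℝ (transition p z) (transition z p x)
  have hT : DifferentiableAt ℝ T y :=
    (hzp.fderiv_right (m := 1) (by rw [one_add_one_eq_two]; exact ENat.LEInfty.out)).differentiableAt one_ne_zero
  have hS : DifferentiableAt ℝ S y := by
    refine DifferentiableAt.comp y (g := fderiv ℝ (transition p z)) ?_
      (hzp.differentiableAt (by simp))
    rw [transition_extChartAt hp]
    exact (hpz.fderiv_right (m := 1) (by rw [one_add_one_eq_two]; exact ENat.LEInfty.out)).differentiableAt one_ne_zero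
  have hcoord : ∀ q, q ∈ (chartAt E z).source → q ∈ (chartAt E p).source →
      (∀ v : TangentSpace 𝓘(ℝ, E) q,
          toCoord p q v = T (extChartAt 𝓘(ℝ, E) z q) (toCoord z q v)) ∧
        (∀ v : TangentSpace 𝓘(ℝ, E) q,
          toCoord z q v = S (extChartAt 𝓘(ℝ, E) z q) (toCoord p q v)) ∧
        ∀ a, ofCoord p q a = ofCoord z q (S (extChartAt 𝓘(ℝ, E) z q) a) := by
    intro q hqz hqp
    have hS' : ∀ v : TangentSpace 𝓘(ℝ, E) q,
        toCoord z q v = S (extChartAt 𝓘(ℝ, E) z q) (toCoord p q v) := fun v ↦ by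
      simp only [S]
      rw [transition_extChartAt hqz, fderiv_transition_toCoord hqp hqz]
    refine ⟨fun v ↦ (fderiv_transition_toCoord hqz hqp v).symm, hS', fun a ↦ ?_⟩
    have := hS' (ofCoord p q a)
    rw [toCoord_ofCoord hqp] at this
    rw [← this, ofCoord_toCoord hqz]
  have hev : ∀ᶠ q in 𝓝 p, q ∈ (chartAt E z).source ∧ q ∈ (chartAt E p).source :=
    ((chartAt E z).open_source.eventually_mem hp).and
      ((chartAt E p).open_source.eventually_mem hpp)
  have hST : ∀ q, q ∈ (chartAt E z).source → q ∈ (chartAt E p).source → ∀ v,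
      S (extChartAt 𝓘(ℝ, E) z q) (T (extChartAt 𝓘(ℝ, E) z q) v) = v := by
    intro q hqz hqp v
    obtain ⟨h1, h2, -⟩ := hcoord q hqz hqp
    have := h1 (ofCoord z q v)
    rw [toCoord_ofCoord hqz] at this
    rw [← this, ← h2, toCoord_ofCoord hqz]
  -- The identity $S(x)T(x)v=v$ is needed on a neighbourhood: differentiating it in $x$ is what
  -- expresses $S'$ through $T'$.
  have hSTev : ∀ v, (fun x ↦ S x (T x v)) =ᶠ[𝓝 y] fun _ ↦ v := by
    intro v
    have hpz' : p ∈ (extChartAt 𝓘(ℝ, E) z).source := by rwa [extChartAt_source]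
    have hc : Tendsto (extChartAt 𝓘(ℝ, E) z).symm (𝓝 y) (𝓝 p) := by
      have := continuousAt_extChartAt_symm' (I := 𝓘(ℝ, E)) hpz'
      rwa [ContinuousAt, (extChartAt 𝓘(ℝ, E) z).left_inv hpz'] at this
    filter_upwards [hc.eventually hev, extChartAt_target_mem_nhds' (I := 𝓘(ℝ, E))
      ((extChartAt 𝓘(ℝ, E) z).map_source hpz')] with x hx hxt
    have := hST _ hx.1 hx.2 v
    rwa [(extChartAt 𝓘(ℝ, E) z).right_inv hxt] at this
  refine ⟨T, S, fderiv ℝ T y, fderiv ℝ S y, hT.hasFDerivAt, hS.hasFDerivAt, ?_,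
    hST p hp hpp, ?_, ?_⟩
  · exact fun u v ↦ hzp.isSymmSndFDerivAt (by simp only [minSmoothness_of_isRCLikeNormedField]; exact ENat.LEInfty.out) u v
  · intro u v
    have h1 := hS.hasFDerivAt.clm_apply (hT.hasFDerivAt.clm_apply (hasFDerivAt_const (𝕜 := ℝ) v y))
    have h2 := (hasFDerivAt_const (𝕜 := ℝ) v y).congr_of_eventuallyEq (hSTev v)
    have h3 := DFunLike.congr_fun (h1.unique h2) u
    simp at h3
    rw [eq_neg_iff_add_eq_zero, add_comm]
    exact h3
  · filter_upwards [hev] with q hq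
    exact ⟨hq.1, hq.2, hcoord q hq.1 hq.2⟩

variable [RiemannianBundle (fun x : M ↦ TangentSpace 𝓘(ℝ, E) x)]
  [IsContMDiffRiemannianBundle 𝓘(ℝ, E) ∞ E (fun x : M ↦ TangentSpace 𝓘(ℝ, E) x)]
  [FiniteDimensional ℝ E]

/-- The derivative of the metric coefficients of the chart at `p`, in terms of the chart at `z`. -/
theorem metricDeriv_eq {T S : E → E →L[ℝ] E} {T' S' : E →L[ℝ] E →L[ℝ] E}
    (hp : p ∈ (chartAt E z).source)
    (hS : HasFDerivAt S S' (extChartAt 𝓘(ℝ, E) z p))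
    (hST : ∀ v, S (extChartAt 𝓘(ℝ, E) z p) (T (extChartAt 𝓘(ℝ, E) z p) v) = v)
    (hS' : ∀ u v, S' u (T (extChartAt 𝓘(ℝ, E) z p) v) = -S (extChartAt 𝓘(ℝ, E) z p) (T' u v))
    (hT : ∀ v : TangentSpace 𝓘(ℝ, E) p,
      toCoord p p v = T (extChartAt 𝓘(ℝ, E) z p) (toCoord z p v))
    (hev : ∀ᶠ q in 𝓝 p, q ∈ (chartAt E z).source ∧ q ∈ (chartAt E p).source ∧
      ∀ a, ofCoord p q a = ofCoord z q (S (extChartAt 𝓘(ℝ, E) z q) a))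
    (u v w : TangentSpace 𝓘(ℝ, E) p) :
    metricDeriv p u v w =
      fderiv ℝ (chartMetric z) (extChartAt 𝓘(ℝ, E) z p) (toCoord z p u) (toCoord z p v)
          (toCoord z p w)
        - chartMetric z (extChartAt 𝓘(ℝ, E) z p)
          (S (extChartAt 𝓘(ℝ, E) z p) (T' (toCoord z p u) (toCoord z p v))) (toCoord z p w)
        - chartMetric z (extChartAt 𝓘(ℝ, E) z p) (toCoord z p v)
          (S (extChartAt 𝓘(ℝ, E) z p) (T' (toCoord z p u) (toCoord z p w))) := by
  set y := extChartAt 𝓘(ℝ, E) z p with hy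
  -- The fields in `metricDeriv` have constant components $T(y)v$, $T(y)w$ in the chart at $p$; in
  -- the chart at $z$ their components at $x$ are $S(x)T(y)v$, $S(x)T(y)w$.
  let G : E → ℝ := fun x ↦ chartMetric z x (S x (T y (toCoord z p v))) (S x (T y (toCoord z p w)))
  have hg : HasFDerivAt (chartMetric z) (fderiv ℝ (chartMetric z) y) y :=
    ((contDiffAt_chartMetric hp).differentiableAt (by simp)).hasFDerivAt
  obtain ⟨G', hG, hG'⟩ : ∃ G' : E →L[ℝ] ℝ, HasFDerivAt G G' y ∧ ∀ x : E,
      G' x = fderiv ℝ (chartMetric z) y x (toCoord z p v) (toCoord z p w)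
        - chartMetric z y (S y (T' x (toCoord z p v))) (toCoord z p w)
        - chartMetric z y (toCoord z p v) (S y (T' x (toCoord z p w))) := by
    refine ⟨_, (hg.clm_apply (hS.clm_apply (hasFDerivAt_const (T y (toCoord z p v)) y))).clm_apply
      (hS.clm_apply (hasFDerivAt_const (T y (toCoord z p w)) y)), fun x ↦ ?_⟩
    simp [hST, hS']
    ring
  have hcomp := hG.hasMFDerivAt.comp p (hasMFDerivAt_extChartAt_toCoord hp)
  have heq : (fun q : M ↦ (inner ℝ (coordField p v q) (coordField p w q) : ℝ)) =ᶠ[𝓝 p]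
      G ∘ extChartAt 𝓘(ℝ, E) z := by
    filter_upwards [hev] with q hq
    rw [coordField_eq hq.2.1, coordField_eq hq.2.1, hq.2.2, hq.2.2, Function.comp_apply]
    simp only [G]
    rw [chartMetric_apply hq.1, hT, hT]
  have h := (hcomp.congr_of_eventuallyEq heq).mfderiv
  rw [metricDeriv, h]
  exact hG' (toCoord z p u)

/-- Each of the three metric derivatives brings two corrections containing $T'$. Symmetry of $T'$
and of the metric cancels four of the six and makes the other two equal, which leaves the classical
inhomogeneous term. -/
theorem christoffel_eq {T S : E → E →L[ℝ] E} {T' S' : E →L[ℝ] E →L[ℝ] E}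
    (hp : p ∈ (chartAt E z).source)
    (hS : HasFDerivAt S S' (extChartAt 𝓘(ℝ, E) z p))
    (hST : ∀ v, S (extChartAt 𝓘(ℝ, E) z p) (T (extChartAt 𝓘(ℝ, E) z p) v) = v)
    (hS' : ∀ u v, S' u (T (extChartAt 𝓘(ℝ, E) z p) v) = -S (extChartAt 𝓘(ℝ, E) z p) (T' u v))
    (hT : ∀ v : TangentSpace 𝓘(ℝ, E) p,
      toCoord p p v = T (extChartAt 𝓘(ℝ, E) z p) (toCoord z p v))
    (hev : ∀ᶠ q in 𝓝 p, q ∈ (chartAt E z).source ∧ q ∈ (chartAt E p).source ∧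
      ∀ a, ofCoord p q a = ofCoord z q (S (extChartAt 𝓘(ℝ, E) z q) a))
    (hsymm : ∀ u v, T' u v = T' v u) (u v w : TangentSpace 𝓘(ℝ, E) p) :
    christoffel p u v w =
      christoffelOf (chartMetric z) (extChartAt 𝓘(ℝ, E) z p) (toCoord z p u) (toCoord z p v)
          (toCoord z p w)
        - chartMetric z (extChartAt 𝓘(ℝ, E) z p)
          (S (extChartAt 𝓘(ℝ, E) z p) (T' (toCoord z p u) (toCoord z p v))) (toCoord z p w) := by
  rw [christoffel, christoffelOf, metricDeriv_eq hp hS hST hS' hT hev,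
    metricDeriv_eq hp hS hST hS' hT hev, metricDeriv_eq hp hS hST hS' hT hev,
    hsymm (toCoord z p v) (toCoord z p u), hsymm (toCoord z p w) (toCoord z p u),
    hsymm (toCoord z p w) (toCoord z p v),
    chartMetric_comm z _ (S _ (T' (toCoord z p u) (toCoord z p w)))]
  ring

end ChangeOfChart

/-! ### The transport equation in a fixed chart, and metric compatibility -/

section ParallelFields

open Set Topology Filter

variable {E : Type*} [NormedAddCommGroup E] [NormedSpace ℝ E]
  {M : Type*} [TopologicalSpace M] [ChartedSpace E M] [IsManifold 𝓘(ℝ, E) ∞ M]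
  {z : M} {γ : ℝ → M} {t : ℝ}

theorem hasDerivAt_bilinear {F : Type*} [NormedAddCommGroup F] [NormedSpace ℝ F]
    {g : F → F →L[ℝ] F →L[ℝ] ℝ} {g' : F →L[ℝ] F →L[ℝ] F →L[ℝ] ℝ}
    {c v w : ℝ → F} {c' v' w' : F} {t : ℝ} (hg : HasFDerivAt g g' (c t)) (hc : HasDerivAt c c' t)
    (hv : HasDerivAt v v' t) (hw : HasDerivAt w w' t) :
    HasDerivAt (fun s ↦ g (c s) (v s) (w s))
      (g' c' (v t) (w t) + g (c t) v' (w t) + g (c t) (v t) w') t := by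
  have h := ((hg.comp_hasDerivAt t hc).clm_apply hv).clm_apply hw
  exact h

theorem apply_comm_of_hasFDerivAt {F : Type*} [NormedAddCommGroup F] [NormedSpace ℝ F]
    {g : F → F →L[ℝ] F →L[ℝ] ℝ} {g' : F →L[ℝ] F →L[ℝ] F →L[ℝ] ℝ} {y : F}
    (hg : HasFDerivAt g g' y) (hcomm : ∀ y a b, g y a b = g y b a) (u a b : F) :
    g' u a b = g' u b a := by
  have h : ∀ a b : F, HasFDerivAt (fun y ↦ g y a b) ((g'.flip a).flip b) y := fun a b ↦
    ((hg.clm_apply (hasFDerivAt_const a y)).clm_apply (hasFDerivAt_const b y)).congr_fderiv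
      (by ext x; simp)
  have hab := h a b
  simp only [fun y ↦ hcomm y a b] at hab
  exact DFunLike.congr_fun (hab.unique (h b a)) u

theorem hasDerivAt_extChartAt_comp (hγ : MDifferentiableAt 𝓘(ℝ, ℝ) 𝓘(ℝ, E) γ t)
    (hz : γ t ∈ (chartAt E z).source) :
    HasDerivAt (fun s ↦ extChartAt 𝓘(ℝ, E) z (γ s)) (toCoord z (γ t) (velocity γ t)) t := by
  have h := (hasMFDerivAt_extChartAt_toCoord hz).comp t hγ.hasMFDerivAt
  have h' : HasFDerivAt (fun s ↦ extChartAt 𝓘(ℝ, E) z (γ s))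
      ((toCoord z (γ t)).comp (mfderiv 𝓘(ℝ, ℝ) 𝓘(ℝ, E) γ t) : ℝ →L[ℝ] E) t :=
    hasMFDerivAt_iff_hasFDerivAt.1 h
  exact HasFDerivAt.hasDerivAt (F := E) h'

variable [RiemannianBundle (fun x : M ↦ TangentSpace 𝓘(ℝ, E) x)]

/-- The vector field `V` along `γ` has vanishing covariant derivative at time `t`. -/
def IsParallelAt (γ : ℝ → M) (V : ∀ t, TangentSpace 𝓘(ℝ, E) (γ t)) (t : ℝ) : Prop :=
  DifferentiableAt ℝ (coordAlong γ V t) t ∧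
    ∀ w : TangentSpace 𝓘(ℝ, E) (γ t),
      inner ℝ ((trivializationAt E (TangentSpace 𝓘(ℝ, E)) (γ t)).symm (γ t)
          (deriv (coordAlong γ V t) t)) w
        + christoffel (γ t) (velocity γ t) (V t) w = 0

variable [IsContMDiffRiemannianBundle 𝓘(ℝ, E) ∞ E (fun x : M ↦ TangentSpace 𝓘(ℝ, E) x)]
  [FiniteDimensional ℝ E]

/-- The equation of parallel transport in an arbitrary chart. -/
theorem isParallelAt_iff {V : ∀ t, TangentSpace 𝓘(ℝ, E) (γ t)}
    (hγ : MDifferentiableAt 𝓘(ℝ, ℝ) 𝓘(ℝ, E) γ t) (hz : γ t ∈ (chartAt E z).source) :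
    IsParallelAt γ V t ↔ DifferentiableAt ℝ (fun s ↦ toCoord z (γ s) (V s)) t ∧
      ∀ w : E, chartMetric z (extChartAt 𝓘(ℝ, E) z (γ t))
          (deriv (fun s ↦ toCoord z (γ s) (V s)) t) w
        + christoffelOf (chartMetric z) (extChartAt 𝓘(ℝ, E) z (γ t))
          (toCoord z (γ t) (velocity γ t)) (toCoord z (γ t) (V t)) w = 0 := by
  obtain ⟨T, S, T', S', hT, hS, hsymm, hST, hS', hev⟩ := exists_hasFDerivAt_transition hz
  have hev' : ∀ᶠ q in 𝓝 (γ t), q ∈ (chartAt E z).source ∧ q ∈ (chartAt E (γ t)).source ∧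
      ∀ a, ofCoord (γ t) q a = ofCoord z q (S (extChartAt 𝓘(ℝ, E) z q) a) :=
    hev.mono fun q hq ↦ ⟨hq.1, hq.2.1, hq.2.2.2.2⟩
  have hc := hasDerivAt_extChartAt_comp hγ hz
  have hγev := hγ.continuousAt.eventually hev
  have h1 : coordAlong γ V t =ᶠ[𝓝 t]
      fun s ↦ T (extChartAt 𝓘(ℝ, E) z (γ s)) (toCoord z (γ s) (V s)) := by
    filter_upwards [hγev] with s hs
    rw [coordAlong, toCoord_apply hs.2.1, hs.2.2.1]
  have h2 : (fun s ↦ toCoord z (γ s) (V s)) =ᶠ[𝓝 t]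
      fun s ↦ S (extChartAt 𝓘(ℝ, E) z (γ s)) (coordAlong γ V t s) := by
    filter_upwards [hγev] with s hs
    rw [coordAlong, toCoord_apply hs.2.1, hs.2.2.2.1]
  have hTc := hT.comp_hasDerivAt t hc
  have hSc := hS.comp_hasDerivAt t hc
  have hdiff : DifferentiableAt ℝ (coordAlong γ V t) t ↔
      DifferentiableAt ℝ (fun s ↦ toCoord z (γ s) (V s)) t := by
    constructor
    · intro h
      exact (hSc.clm_apply h.hasDerivAt).differentiableAt.congr_of_eventuallyEq h2
    · intro h
      exact (hTc.clm_apply h.hasDerivAt).differentiableAt.congr_of_eventuallyEq h1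
  rw [IsParallelAt, hdiff]
  refine and_congr_right fun h ↦ ?_
  have hd : deriv (coordAlong γ V t) t = _ :=
    ((hTc.clm_apply h.hasDerivAt).congr_of_eventuallyEq h1).deriv
  have hpt := hev.self_of_nhds
  -- By the product rule the components in the chart at $\gamma(t)$ have derivative $T'(c')V+TV'$.
  -- Applying $S$ produces an extra $ST'(c',V)$, which cancels the inhomogeneous term of
  -- `christoffel_eq`.
  have key : ∀ w : TangentSpace 𝓘(ℝ, E) (γ t),
      inner ℝ ((trivializationAt E (TangentSpace 𝓘(ℝ, E)) (γ t)).symm (γ t)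
          (deriv (coordAlong γ V t) t)) w + christoffel (γ t) (velocity γ t) (V t) w =
      chartMetric z (extChartAt 𝓘(ℝ, E) z (γ t))
          (deriv (fun s ↦ toCoord z (γ s) (V s)) t) (toCoord z (γ t) w)
        + christoffelOf (chartMetric z) (extChartAt 𝓘(ℝ, E) z (γ t))
          (toCoord z (γ t) (velocity γ t)) (toCoord z (γ t) (V t)) (toCoord z (γ t) w) := by
    intro w
    rw [ofCoord_apply hpt.2.1, christoffel_eq hz hS hST hS' hpt.2.2.1 hev' hsymm, hd,
      hpt.2.2.2.2]
    have hw : w = ofCoord z (γ t) (toCoord z (γ t) w) := (ofCoord_toCoord hz w).symm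
    conv_lhs => enter [1]; rw [hw]
    simp only [Function.comp_apply]
    rw [← chartMetric_apply hz, map_add, hST, map_add, add_apply]
    ring
  constructor
  · intro hw w
    have := key (ofCoord z (γ t) w)
    rw [toCoord_ofCoord hz] at this
    rw [← this]
    exact hw _
  · intro hw w
    rw [key]
    exact hw _

theorem fderiv_chartMetric_comm {q : M} (hq : q ∈ (chartAt E z).source) (u a b : E) :
    fderiv ℝ (chartMetric z) (extChartAt 𝓘(ℝ, E) z q) u a b =
      fderiv ℝ (chartMetric z) (extChartAt 𝓘(ℝ, E) z q) u b a := by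
  exact apply_comm_of_hasFDerivAt
    ((contDiffAt_chartMetric hq).differentiableAt (by simp)).hasFDerivAt (chartMetric_comm z) u a b

/-- The inner product of two parallel fields has derivative zero. -/
theorem IsParallelAt.hasDerivAt_inner {V W : ∀ t, TangentSpace 𝓘(ℝ, E) (γ t)}
    (hγ : MDifferentiableAt 𝓘(ℝ, ℝ) 𝓘(ℝ, E) γ t)
    (hV : IsParallelAt γ V t) (hW : IsParallelAt γ W t) :
    HasDerivAt (fun s ↦ (inner ℝ (V s) (W s) : ℝ)) 0 t := by
  have hz : γ t ∈ (chartAt E (γ t)).source := mem_chart_source E _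
  obtain ⟨hVd, hV⟩ := (isParallelAt_iff hγ hz).1 hV
  obtain ⟨hWd, hW⟩ := (isParallelAt_iff hγ hz).1 hW
  have hc := hasDerivAt_extChartAt_comp hγ hz
  have h := hasDerivAt_bilinear
    ((contDiffAt_chartMetric hz).differentiableAt (by simp)).hasFDerivAt hc
    hVd.hasDerivAt hWd.hasDerivAt
  have heq : (fun s ↦ (inner ℝ (V s) (W s) : ℝ)) =ᶠ[𝓝 t]
      fun s ↦ chartMetric (γ t) (extChartAt 𝓘(ℝ, E) (γ t) (γ s))
        (toCoord (γ t) (γ s) (V s)) (toCoord (γ t) (γ s) (W s)) := by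
    filter_upwards [hγ.continuousAt.eventually ((chartAt E (γ t)).open_source.eventually_mem hz)]
      with s hs
    rw [chartMetric_apply hs, ofCoord_toCoord hs, ofCoord_toCoord hs]
  refine (h.congr_of_eventuallyEq heq).congr_deriv ?_
  -- Test each equation against the other field and add: the terms antisymmetric in the two fields
  -- cancel, and the Christoffel symbols sum to the derivative of the metric along $\gamma$.
  have e1 := hV (toCoord (γ t) (γ t) (W t))
  have e2 := hW (toCoord (γ t) (γ t) (V t))
  rw [chartMetric_comm] at e2
  simp only [christoffelOf] at e1 e2
  rw [fderiv_chartMetric_comm hz _ (toCoord (γ t) (γ t) (W t)) (toCoord (γ t) (γ t) (V t))] at e2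
  linarith

end ParallelFields

/-! ### Existence, uniqueness and isometry of parallel transport -/

section ParallelTransport

open Set Topology Filter

variable {E : Type*} [NormedAddCommGroup E] [NormedSpace ℝ E] [FiniteDimensional ℝ E]
  {M : Type*} [TopologicalSpace M] [ChartedSpace E M] [IsManifold 𝓘(ℝ, E) ∞ M]
  [RiemannianBundle (fun x : M ↦ TangentSpace 𝓘(ℝ, E) x)]
  {z : M} {γ : ℝ → M} {t : ℝ}

/-- A definite bilinear form on a finite-dimensional space is invertible. -/
theorem isInvertible_of_definite {F : Type*} [NormedAddCommGroup F] [NormedSpace ℝ F]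
    [FiniteDimensional ℝ F] {g : F →L[ℝ] F →L[ℝ] ℝ} (hg : ∀ a, g a a = 0 → a = 0) :
    g.IsInvertible := by
  have hinj : Function.Injective (g : F →ₗ[ℝ] F →L[ℝ] ℝ) := by
    rw [← LinearMap.ker_eq_bot, LinearMap.ker_eq_bot']
    intro a ha
    have ha' : g a = 0 := ha
    exact hg a (by rw [ha', zero_apply])
  have hrank : Module.finrank ℝ F = Module.finrank ℝ (F →L[ℝ] ℝ) := by
    rw [← (LinearMap.toContinuousLinearMap (𝕜 := ℝ) (E := F) (F' := ℝ)).finrank_eq]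
    exact Subspace.dual_finrank_eq.symm
  refine ⟨(LinearEquiv.ofInjectiveOfFinrankEq _ hinj hrank).toContinuousLinearEquiv, ?_⟩
  ext a b
  rfl

/-- The bilinear form `(v, w) ↦ ⟨Γ(u, v), w⟩` attached to the derivative `D` of a metric. -/
def christoffelForm {F : Type*} [NormedAddCommGroup F] [NormedSpace ℝ F]
    (D : F →L[ℝ] F →L[ℝ] F →L[ℝ] ℝ) (u : F) : F →L[ℝ] F →L[ℝ] ℝ :=
  (1 / 2 : ℝ) • (D u + D.flip u - (D.flip u).flip)

theorem christoffelForm_apply {F : Type*} [NormedAddCommGroup F] [NormedSpace ℝ F]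
    (g : F → F →L[ℝ] F →L[ℝ] ℝ) (y u v w : F) :
    christoffelForm (fderiv ℝ g y) u v w = christoffelOf g y u v w := by
  simp only [christoffelForm, christoffelOf, smul_apply, sub_apply, add_apply,
    ContinuousLinearMap.flip_apply, smul_eq_mul]
  ring

theorem continuousAt_christoffelForm {F : Type*} [NormedAddCommGroup F] [NormedSpace ℝ F]
    {D : ℝ → F →L[ℝ] F →L[ℝ] F →L[ℝ] ℝ} {u : ℝ → F} {t : ℝ} (hD : ContinuousAt D t)
    (hu : ContinuousAt u t) : ContinuousAt (fun s ↦ christoffelForm (D s) (u s)) t := by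
  have hflip : ContinuousAt (fun s ↦ (D s).flip) t :=
    (ContinuousLinearMap.flipₗᵢ ℝ F F (F →L[ℝ] ℝ)).continuous.continuousAt.comp hD
  have h2 : ContinuousAt (fun s ↦ (D s).flip (u s)) t := hflip.clm_apply hu
  have h3 : ContinuousAt (fun s ↦ ((D s).flip (u s)).flip) t :=
    (ContinuousLinearMap.flipₗᵢ ℝ F F ℝ).continuous.continuousAt.comp h2
  exact (((hD.clm_apply hu).add h2).sub h3).const_smul (1 / 2 : ℝ)

/-- The coefficients of the equation of parallel transport are continuous. -/
theorem continuousAt_neg_inverse_comp {F : Type*} [NormedAddCommGroup F] [NormedSpace ℝ F]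
    [CompleteSpace F] {g C : ℝ → F →L[ℝ] F →L[ℝ] ℝ} {t : ℝ} (hg : ContinuousAt g t)
    (hC : ContinuousAt C t) (hinv : (g t).IsInvertible) :
    ContinuousAt (fun s ↦ -(g s).inverse.comp (C s)) t := by
  obtain ⟨e, he⟩ := hinv
  have h1 : ContinuousAt (ContinuousLinearMap.inverse : (F →L[ℝ] F →L[ℝ] ℝ) → _) (g t) := by
    rw [← he]
    exact (contDiffAt_map_inverse (n := 0) e).continuousAt
  exact ((ContinuousAt.comp (f := g) h1 hg).clm_comp hC).neg

variable [IsContMDiffRiemannianBundle 𝓘(ℝ, E) ∞ E (fun x : M ↦ TangentSpace 𝓘(ℝ, E) x)]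

/-- A definite metric matrix $g$ is invertible, so in one chart the transport equation is the linear
system $V'=-g^{-1}\Gamma(c',V)$ with continuous coefficients. The time interval is the same for all
initial vectors, which the gluing below relies on. -/
theorem exists_isParallelAt_near (hγ : ContMDiff 𝓘(ℝ, ℝ) 𝓘(ℝ, E) ∞ γ) (t₀ : ℝ) :
    ∃ ε > 0, ∀ s ∈ Ioo (t₀ - ε) (t₀ + ε), ∀ u : TangentSpace 𝓘(ℝ, E) (γ s),
      ∃ V : ∀ t, TangentSpace 𝓘(ℝ, E) (γ t), V s = u ∧
        ∀ t ∈ Ioo (t₀ - ε) (t₀ + ε), IsParallelAt γ V t := by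
  set z := γ t₀ with hz
  let c : ℝ → E := fun s ↦ extChartAt 𝓘(ℝ, E) z (γ s)
  let g : ℝ → E →L[ℝ] E →L[ℝ] ℝ := fun s ↦ chartMetric z (c s)
  let C : ℝ → E →L[ℝ] E →L[ℝ] ℝ :=
    fun s ↦ christoffelForm (fderiv ℝ (chartMetric z) (c s)) (deriv c s)
  have hsrc : ∀ᶠ t in 𝓝 t₀, γ t ∈ (chartAt E z).source :=
    hγ.continuous.continuousAt.eventually
      ((chartAt E z).open_source.eventually_mem (mem_chart_source E z))
  have hinv : ∀ t, γ t ∈ (chartAt E z).source → (g t).IsInvertible := fun t ht ↦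
    isInvertible_of_definite fun a ha ↦ eq_zero_of_chartMetric ht ha
  have hcont : ∀ t, γ t ∈ (chartAt E z).source →
      ContinuousAt (fun s ↦ -(g s).inverse.comp (C s)) t := by
    intro t ht
    have hc : ContDiffAt ℝ ∞ c t := by
      rw [← contMDiffAt_iff_contDiffAt]
      exact (contMDiffAt_extChartAt' ht).comp t hγ.contMDiffAt
    have hc' : ContinuousAt (deriv c) t := by
      have := (hc.fderiv_right (m := 0) (by simp)).continuousAt
      exact this.clm_apply continuousAt_const
    have hg := contDiffAt_chartMetric ht
    have hg' : ContinuousAt (fderiv ℝ (chartMetric z)) (c t) :=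
      (hg.fderiv_right (m := 0) (by simp)).continuousAt
    exact continuousAt_neg_inverse_comp (ContinuousAt.comp (f := c) hg.continuousAt hc.continuousAt)
      (continuousAt_christoffelForm (ContinuousAt.comp (f := c) hg' hc.continuousAt) hc')
      (hinv t ht)
  obtain ⟨ε₁, hε₁, hode⟩ := exists_forall_hasDerivAt_linear (hsrc.mono hcont)
  obtain ⟨ε₂, hε₂, hsrc'⟩ := Metric.eventually_nhds_iff.1 hsrc
  have hsub : Ioo (t₀ - min ε₁ ε₂) (t₀ + min ε₁ ε₂) ⊆ Ioo (t₀ - ε₁) (t₀ + ε₁) :=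
    Ioo_subset_Ioo (by linarith [min_le_left ε₁ ε₂]) (by linarith [min_le_left ε₁ ε₂])
  have hmem : ∀ t ∈ Ioo (t₀ - min ε₁ ε₂) (t₀ + min ε₁ ε₂), γ t ∈ (chartAt E z).source := by
    intro t ht
    refine hsrc' ?_
    rw [Real.dist_eq, abs_lt]
    constructor <;> linarith [ht.1, ht.2, min_le_right ε₁ ε₂]
  refine ⟨min ε₁ ε₂, by positivity, fun s hs u ↦ ?_⟩
  obtain ⟨v, hvs, hv⟩ := hode s (hsub hs) (toCoord z (γ s) u)
  refine ⟨fun t ↦ ofCoord z (γ t) (v t), ?_, fun t ht ↦ ?_⟩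
  · simp only [hvs, ofCoord_toCoord (hmem s hs)]
  · have hγt : MDifferentiableAt 𝓘(ℝ, ℝ) 𝓘(ℝ, E) γ t := hγ.contMDiffAt.mdifferentiableAt (by simp)
    rw [isParallelAt_iff hγt (hmem t ht)]
    have heq : (fun s ↦ toCoord z (γ s) (ofCoord z (γ s) (v s))) =ᶠ[𝓝 t] v := by
      filter_upwards [isOpen_Ioo.mem_nhds ht] with s hs
      rw [toCoord_ofCoord (hmem s hs)]
    have hd := (hv t (hsub ht)).congr_of_eventuallyEq heq
    refine ⟨hd.differentiableAt, fun w ↦ ?_⟩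
    rw [hd.deriv, toCoord_ofCoord (hmem t ht), ← christoffelForm_apply,
      ← (hasDerivAt_extChartAt_comp hγt (hmem t ht)).deriv]
    change g t ((-(g t).inverse.comp (C t)) (v t)) w + C t (v t) w = 0
    obtain ⟨e, he⟩ := hinv t (hmem t ht)
    rw [neg_apply, map_neg, neg_apply, ContinuousLinearMap.comp_apply, ← he,
      ContinuousLinearMap.inverse_equiv]
    simp

theorem IsParallelAt.smul_add_smul (hγ : MDifferentiableAt 𝓘(ℝ, ℝ) 𝓘(ℝ, E) γ t)
    {V W : ∀ t, TangentSpace 𝓘(ℝ, E) (γ t)} (hV : IsParallelAt γ V t) (hW : IsParallelAt γ W t)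
    (a b : ℝ) : IsParallelAt γ (fun s ↦ a • V s + b • W s) t := by
  have hz : γ t ∈ (chartAt E (γ t)).source := mem_chart_source E _
  obtain ⟨hVd, hV⟩ := (isParallelAt_iff hγ hz).1 hV
  obtain ⟨hWd, hW⟩ := (isParallelAt_iff hγ hz).1 hW
  rw [isParallelAt_iff hγ hz]
  have hd := (hVd.hasDerivAt.const_smul a).add (hWd.hasDerivAt.const_smul b)
  have heq : (fun s ↦ toCoord (γ t) (γ s) (a • V s + b • W s)) =
      (a • fun s ↦ toCoord (γ t) (γ s) (V s)) + b • fun s ↦ toCoord (γ t) (γ s) (W s) := by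
    ext s
    simp
  rw [heq]
  refine ⟨hd.differentiableAt, fun w ↦ ?_⟩
  rw [hd.deriv]
  have e1 := hV w
  have e2 := hW w
  rw [← christoffelForm_apply] at e1 e2 ⊢
  rw [map_add, map_smul, map_smul, map_add, map_smul, map_smul, map_add, map_smul, map_smul]
  simp only [add_apply, smul_apply, smul_eq_mul]
  linear_combination a * e1 + b * e2

theorem IsParallelAt.congr (hγ : MDifferentiableAt 𝓘(ℝ, ℝ) 𝓘(ℝ, E) γ t)
    {V W : ∀ t, TangentSpace 𝓘(ℝ, E) (γ t)} (hV : IsParallelAt γ V t)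
    (h : ∀ᶠ s in 𝓝 t, W s = V s) : IsParallelAt γ W t := by
  have hz : γ t ∈ (chartAt E (γ t)).source := mem_chart_source E _
  obtain ⟨hVd, hV⟩ := (isParallelAt_iff hγ hz).1 hV
  have heq : (fun s ↦ toCoord (γ t) (γ s) (W s)) =ᶠ[𝓝 t]
      fun s ↦ toCoord (γ t) (γ s) (V s) := h.mono fun s hs ↦ by simp only [hs]
  rw [isParallelAt_iff hγ hz, heq.deriv_eq, h.self_of_nhds]
  exact ⟨hVd.congr_of_eventuallyEq heq, hV⟩

theorem inner_eq_of_isParallelAt (hγ : ContMDiff 𝓘(ℝ, ℝ) 𝓘(ℝ, E) ∞ γ) {U : Set ℝ}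
    (hU : IsOpen U) (hU' : IsPreconnected U) {V W : ∀ t, TangentSpace 𝓘(ℝ, E) (γ t)}
    (hV : ∀ t ∈ U, IsParallelAt γ V t) (hW : ∀ t ∈ U, IsParallelAt γ W t) {a b : ℝ}
    (ha : a ∈ U) (hb : b ∈ U) :
    (inner ℝ (V a) (W a) : ℝ) = inner ℝ (V b) (W b) := by
  have hd : ∀ t ∈ U, HasDerivAt (fun s ↦ (inner ℝ (V s) (W s) : ℝ)) 0 t := fun t ht ↦
    (hV t ht).hasDerivAt_inner (hγ.contMDiffAt.mdifferentiableAt (by simp)) (hW t ht)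
  exact hU.is_const_of_deriv_eq_zero hU'
    (fun t ht ↦ (hd t ht).differentiableAt.differentiableWithinAt)
    (fun t ht ↦ (hd t ht).deriv) ha hb

/-- The difference of two parallel fields is parallel, so its norm is constant; it vanishes at $a$,
hence throughout $U$. -/
theorem eq_of_isParallelAt (hγ : ContMDiff 𝓘(ℝ, ℝ) 𝓘(ℝ, E) ∞ γ) {U : Set ℝ}
    (hU : IsOpen U) (hU' : IsPreconnected U) {V W : ∀ t, TangentSpace 𝓘(ℝ, E) (γ t)}
    (hV : ∀ t ∈ U, IsParallelAt γ V t) (hW : ∀ t ∈ U, IsParallelAt γ W t) {a b : ℝ}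
    (ha : a ∈ U) (hb : b ∈ U) (h : V a = W a) : V b = W b := by
  have hsub : ∀ t ∈ U, IsParallelAt γ (fun s ↦ (1 : ℝ) • V s + (-1 : ℝ) • W s) t := fun t ht ↦
    (hV t ht).smul_add_smul (hγ.contMDiffAt.mdifferentiableAt (by simp)) (hW t ht) _ _
  have := inner_eq_of_isParallelAt hγ hU hU' hsub hsub ha hb
  simp only [h, one_smul, neg_one_smul, add_neg_cancel, inner_zero_left] at this
  have h0 := inner_self_eq_zero.1 this.symm
  exact eq_of_sub_eq_zero (by rw [sub_eq_add_neg]; exact h0)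

/-- Parallel fields with arbitrary initial values exist on `U`. -/
def ParallelSolvableOn (γ : ℝ → M) (U : Set ℝ) : Prop :=
  ∀ s ∈ U, ∀ u : TangentSpace 𝓘(ℝ, E) (γ s), ∃ V : ∀ t, TangentSpace 𝓘(ℝ, E) (γ t),
    V s = u ∧ ∀ t ∈ U, IsParallelAt γ V t

/-- The solution on $U$ is restarted on $U'$ from its value at $y$. Uniqueness on the connected
overlap makes the two agree there, so the piecewise field is parallel on the union. -/
theorem ParallelSolvableOn.exists_union (hγ : ContMDiff 𝓘(ℝ, ℝ) 𝓘(ℝ, E) ∞ γ) {U U' : Set ℝ}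
    (hU : IsOpen U) (hU' : IsOpen U') (hc : IsPreconnected (U ∩ U')) {y : ℝ} (hy : y ∈ U ∩ U')
    (h : ParallelSolvableOn (E := E) γ U) (h' : ParallelSolvableOn (E := E) γ U')
    {s : ℝ} (hs : s ∈ U) (u : TangentSpace 𝓘(ℝ, E) (γ s)) :
    ∃ V : ∀ t, TangentSpace 𝓘(ℝ, E) (γ t), V s = u ∧ ∀ t ∈ U ∪ U', IsParallelAt γ V t := by
  classical
  obtain ⟨V, hVs, hV⟩ := h s hs u
  obtain ⟨W, hWy, hW⟩ := h' y hy.2 (V y)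
  have hVW : ∀ t ∈ U ∩ U', V t = W t := fun t ht ↦
    eq_of_isParallelAt hγ (hU.inter hU') hc (fun t ht ↦ hV t ht.1) (fun t ht ↦ hW t ht.2) hy ht
      hWy.symm
  refine ⟨fun t ↦ if t ∈ U then V t else W t, by simp [hs, hVs], fun t ht ↦ ?_⟩
  have hγt : MDifferentiableAt 𝓘(ℝ, ℝ) 𝓘(ℝ, E) γ t := hγ.contMDiffAt.mdifferentiableAt (by simp)
  rcases ht with ht | ht
  · refine (hV t ht).congr hγt ?_
    filter_upwards [hU.mem_nhds ht] with s hs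
    simp [hs]
  · refine (hW t ht).congr hγt ?_
    filter_upwards [hU'.mem_nhds ht] with s hs
    by_cases hsU : s ∈ U
    · simp [hsU, hVW s ⟨hsU, hs⟩]
    · simp [hsU]

/-- Lying in a common connected open set where transport is solvable is a relation that holds
between nearby times and is transitive by gluing, so connectedness of $\mathbb R$ extends it to all
pairs. Connected subsets of the line are order-connected, which keeps the overlaps connected. -/
theorem exists_parallelSolvableOn (hγ : ContMDiff 𝓘(ℝ, ℝ) 𝓘(ℝ, E) ∞ γ) (a b : ℝ) :
    ∃ U : Set ℝ, IsOpen U ∧ IsPreconnected U ∧ a ∈ U ∧ b ∈ U ∧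
      ParallelSolvableOn (E := E) γ U := by
  refine PreconnectedSpace.induction₂' (fun a b : ℝ ↦ ∃ U : Set ℝ, IsOpen U ∧ IsPreconnected U ∧
    a ∈ U ∧ b ∈ U ∧ ParallelSolvableOn (E := E) γ U) (fun x ↦ ?_) ⟨?_⟩ a b
  · obtain ⟨ε, hε, h⟩ := exists_isParallelAt_near hγ x
    have hx : x ∈ Ioo (x - ε) (x + ε) := ⟨by linarith, by linarith⟩
    filter_upwards [isOpen_Ioo.mem_nhds hx] with y hy
    exact ⟨⟨_, isOpen_Ioo, isPreconnected_Ioo, hx, hy, h⟩,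
      ⟨_, isOpen_Ioo, isPreconnected_Ioo, hy, hx, h⟩⟩
  · rintro x y w ⟨U, hU, hUc, hxU, hyU, h⟩ ⟨U', hU', hUc', hyU', hwU', h'⟩
    have hc : IsPreconnected (U ∩ U') :=
      (hUc.ordConnected.inter hUc'.ordConnected).isPreconnected
    refine ⟨U ∪ U', hU.union hU', hUc.union y hyU hyU' hUc', Or.inl hxU, Or.inr hwU', ?_⟩
    intro s hs u
    rcases hs with hs | hs
    · exact h.exists_union hγ hU hU' hc ⟨hyU, hyU'⟩ h' hs u
    · rw [inter_comm] at hc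
      rw [union_comm]
      exact h'.exists_union hγ hU' hU hc ⟨hyU', hyU⟩ h hs u

/-- Parallel fields with arbitrary initial values exist along any smooth curve. -/
theorem exists_isParallelAlong (hγ : ContMDiff 𝓘(ℝ, ℝ) 𝓘(ℝ, E) ∞ γ) (a : ℝ)
    (u : TangentSpace 𝓘(ℝ, E) (γ a)) :
    ∃ V : ∀ t, TangentSpace 𝓘(ℝ, E) (γ t), IsParallelAlong γ V ∧ V a = u := by
  -- For each $t$ there is a solution $V_t$ on a set containing $a$ and $t$. The global field is the
  -- diagonal $t\mapsto V_t(t)$, which near $t$ equals $V_t$ by uniqueness.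
  choose U hU hUc haU htU hsol using fun t ↦ exists_parallelSolvableOn (E := E) hγ a t
  choose V hVa hV using fun t ↦ hsol t a (haU t) u
  have heq : ∀ t, ∀ s ∈ U t, V s s = V t s := fun t s hs ↦
    eq_of_isParallelAt hγ ((hU s).inter (hU t))
      (((hUc s).ordConnected.inter (hUc t).ordConnected).isPreconnected)
      (fun r hr ↦ hV s r hr.1) (fun r hr ↦ hV t r hr.2) ⟨haU s, haU t⟩ ⟨htU s, hs⟩
      ((hVa s).trans (hVa t).symm)
  refine ⟨fun t ↦ V t t, fun t ↦ ?_, hVa a⟩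
  refine IsParallelAt.congr (hγ.contMDiffAt.mdifferentiableAt (by simp)) (hV t t (htU t)) ?_
  filter_upwards [(hU t).mem_nhds (htU t)] with s hs
  exact heq t s hs

theorem IsParallelAlong.inner_eq (hγ : ContMDiff 𝓘(ℝ, ℝ) 𝓘(ℝ, E) ∞ γ)
    {V W : ∀ t, TangentSpace 𝓘(ℝ, E) (γ t)} (hV : IsParallelAlong γ V)
    (hW : IsParallelAlong γ W) (a b : ℝ) :
    (inner ℝ (V a) (W a) : ℝ) = inner ℝ (V b) (W b) :=
  inner_eq_of_isParallelAt hγ isOpen_univ isPreconnected_univ (fun t _ ↦ hV t) (fun t _ ↦ hW t)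
    (mem_univ a) (mem_univ b)

theorem IsParallelAlong.eq_of_eq (hγ : ContMDiff 𝓘(ℝ, ℝ) 𝓘(ℝ, E) ∞ γ)
    {V W : ∀ t, TangentSpace 𝓘(ℝ, E) (γ t)} (hV : IsParallelAlong γ V)
    (hW : IsParallelAlong γ W) {a : ℝ} (h : V a = W a) (b : ℝ) : V b = W b :=
  eq_of_isParallelAt hγ isOpen_univ isPreconnected_univ (fun t _ ↦ hV t) (fun t _ ↦ hW t)
    (mem_univ a) (mem_univ b) h

theorem IsParallelAlong.smul_add_smul (hγ : ContMDiff 𝓘(ℝ, ℝ) 𝓘(ℝ, E) ∞ γ)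
    {V W : ∀ t, TangentSpace 𝓘(ℝ, E) (γ t)} (hV : IsParallelAlong γ V)
    (hW : IsParallelAlong γ W) (a b : ℝ) : IsParallelAlong γ (fun s ↦ a • V s + b • W s) :=
  fun t ↦ IsParallelAt.smul_add_smul (hγ.contMDiffAt.mdifferentiableAt (by simp)) (hV t) (hW t) a b

/-- Parallel transport along a smooth curve is a linear isometry. -/
theorem exists_linearIsometryEquiv_transport (hγ : ContMDiff 𝓘(ℝ, ℝ) 𝓘(ℝ, E) ∞ γ) (a b : ℝ) :
    ∃ T : TangentSpace 𝓘(ℝ, E) (γ a) ≃ₗᵢ[ℝ] TangentSpace 𝓘(ℝ, E) (γ b),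
      ∀ V : ∀ t, TangentSpace 𝓘(ℝ, E) (γ t), IsParallelAlong γ V → T (V a) = V b := by
  choose V hV hVa using fun u ↦ exists_isParallelAlong (E := E) hγ a u
  have key : ∀ W : ∀ t, TangentSpace 𝓘(ℝ, E) (γ t), IsParallelAlong γ W →
      V (W a) b = W b := fun W hW ↦ (hV (W a)).eq_of_eq hγ hW (hVa (W a)) b
  have hlin : ∀ (c d : ℝ) (u w : TangentSpace 𝓘(ℝ, E) (γ a)),
      V (c • u + d • w) b = c • V u b + d • V w b := by
    intro c d u w
    have := key _ ((hV u).smul_add_smul hγ (hV w) c d)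
    simpa only [hVa] using this
  let T : TangentSpace 𝓘(ℝ, E) (γ a) →ₗ[ℝ] TangentSpace 𝓘(ℝ, E) (γ b) :=
    { toFun := fun u ↦ V u b
      map_add' := fun u w ↦ by simpa using hlin 1 1 u w
      map_smul' := fun c u ↦ by simpa using hlin c 0 u u }
  let T' : TangentSpace 𝓘(ℝ, E) (γ a) →ₗᵢ[ℝ] TangentSpace 𝓘(ℝ, E) (γ b) :=
    { T with
      norm_map' := fun u ↦ by
        have := (hV u).inner_eq hγ (hV u) b a
        rw [hVa, real_inner_self_eq_norm_sq, real_inner_self_eq_norm_sq] at this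
        exact (pow_left_inj₀ (norm_nonneg _) (norm_nonneg _) two_ne_zero).1 this }
  have hsurj : Function.Surjective T' := by
    intro w
    obtain ⟨W, hW, hWb⟩ := exists_isParallelAlong hγ b w
    exact ⟨W a, (key W hW).trans hWb⟩
  exact ⟨LinearIsometryEquiv.ofSurjective T' hsurj, key⟩

end ParallelTransport

/-! ### Geodesics, the quadratic upper bound and smoothness of the objective -/

section Geodesics

open Set Topology Filter

variable {E : Type*} [NormedAddCommGroup E] [NormedSpace ℝ E]
  {M : Type*} [TopologicalSpace M] [ChartedSpace E M] [IsManifold 𝓘(ℝ, E) ∞ M]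
  {γ : ℝ → M}

theorem velocity_comp_mul {E M : Type*} [NormedAddCommGroup E] [NormedSpace ℝ E]
    [TopologicalSpace M] [ChartedSpace E M] {γ : ℝ → M} (c t : ℝ)
    (hγ : MDifferentiableAt 𝓘(ℝ, ℝ) 𝓘(ℝ, E) γ (c * t)) :
    velocity (E := E) (fun s ↦ γ (c * s)) t = c • velocity (E := E) γ (c * t) := by
  have hc : HasFDerivAt (fun s : ℝ ↦ c * s) (c • ContinuousLinearMap.id ℝ ℝ) t := by
    simpa using (hasFDerivAt_id t).const_mul c
  have h : HasMFDerivAt 𝓘(ℝ, ℝ) 𝓘(ℝ, E) (fun s ↦ γ (c * s)) t _ :=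
    hγ.hasMFDerivAt.comp t hc.hasMFDerivAt
  have h1 : velocity (E := E) (fun s ↦ γ (c * s)) t =
      mfderiv 𝓘(ℝ, ℝ) 𝓘(ℝ, E) γ (c * t) (c • (1 : ℝ)) := by
    rw [velocity, h.mfderiv]
    rfl
  rw [h1]
  exact map_smul (mfderiv 𝓘(ℝ, ℝ) 𝓘(ℝ, E) γ (c * t)) c (1 : ℝ)

theorem contMDiff_comp_mul {E M : Type*} [NormedAddCommGroup E] [NormedSpace ℝ E]
    [TopologicalSpace M] [ChartedSpace E M] {γ : ℝ → M}
    (hγ : ContMDiff 𝓘(ℝ, ℝ) 𝓘(ℝ, E) ∞ γ) (c : ℝ) :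
    ContMDiff 𝓘(ℝ, ℝ) 𝓘(ℝ, E) ∞ (fun s ↦ γ (c * s)) :=
  hγ.comp (contDiff_const.mul contDiff_id).contMDiff

variable [RiemannianBundle (fun x : M ↦ TangentSpace 𝓘(ℝ, E) x)]
  [FiniteDimensional ℝ E]

variable {L : ℝ} {f : M → ℝ}

theorem GeodesicallySmooth.norm_sub_le (hf : GeodesicallySmooth E L f)
    (hγ : IsGeodesic (E := E) γ) {V : ∀ t, TangentSpace 𝓘(ℝ, E) (γ t)}
    (hV : IsParallelAlong γ V) (h1 : V 1 = grad f (γ 1)) :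
    ‖grad f (γ 0) - V 0‖ ≤ L * ‖velocity (E := E) γ 0‖ :=
  hf.2 γ hγ (V 0) ⟨V, hV, by rw [h1], rfl⟩

variable [IsContMDiffRiemannianBundle 𝓘(ℝ, E) ∞ E (fun x : M ↦ TangentSpace 𝓘(ℝ, E) x)]

/-- Under the time change $s\mapsto cs$ both $V'$ and the velocity inside $\Gamma(\gamma',V)$
acquire the factor $c$, so the equation is merely multiplied by $c$; $c=0$ is allowed. -/
theorem IsParallelAlong.comp_mul (hγ : ContMDiff 𝓘(ℝ, ℝ) 𝓘(ℝ, E) ∞ γ)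
    {V : ∀ t, TangentSpace 𝓘(ℝ, E) (γ t)} (hV : IsParallelAlong γ V) (c : ℝ) :
    IsParallelAlong (fun s ↦ γ (c * s)) (fun s ↦ V (c * s)) := by
  intro t
  have hγt : MDifferentiableAt 𝓘(ℝ, ℝ) 𝓘(ℝ, E) γ (c * t) :=
    hγ.contMDiffAt.mdifferentiableAt (by simp)
  have hγc : MDifferentiableAt 𝓘(ℝ, ℝ) 𝓘(ℝ, E) (fun s ↦ γ (c * s)) t :=
    (contMDiff_comp_mul hγ c).contMDiffAt.mdifferentiableAt (by simp)
  have hz : γ (c * t) ∈ (chartAt E (γ (c * t))).source := mem_chart_source E _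
  obtain ⟨hd, hw⟩ := (isParallelAt_iff hγt hz).1 (hV (c * t))
  refine (isParallelAt_iff hγc hz).2 ?_
  have hd' : HasDerivAt (fun s ↦ toCoord (γ (c * t)) (γ (c * s)) (V (c * s)))
      (c • deriv (fun s ↦ toCoord (γ (c * t)) (γ s) (V s)) (c * t)) t := by
    have hc : HasDerivAt (fun s : ℝ ↦ c * s) c t := by
      simpa using (hasDerivAt_id t).const_mul c
    exact hd.hasDerivAt.scomp t hc
  refine ⟨hd'.differentiableAt, fun w ↦ ?_⟩
  rw [hd'.deriv, velocity_comp_mul c t hγt]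
  have e := hw w
  rw [← christoffelForm_apply] at e ⊢
  have hform : ∀ (D : E →L[ℝ] E →L[ℝ] E →L[ℝ] ℝ) (u v w : E),
      christoffelForm D (c • u) v w = c * christoffelForm D u v w := by
    intro D u v w
    simp only [christoffelForm, smul_apply, sub_apply, add_apply, ContinuousLinearMap.flip_apply,
      map_smul, smul_eq_mul]
    ring
  rw [map_smul, map_smul, hform, smul_apply, smul_eq_mul, ← mul_add, e, mul_zero]

theorem IsGeodesic.comp_mul (hγ : IsGeodesic (E := E) γ) (c : ℝ) :
    IsGeodesic (E := E) (fun s ↦ γ (c * s)) := by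
  refine ⟨contMDiff_comp_mul hγ.1 c, ?_⟩
  have h := (hγ.2.comp_mul hγ.1 c).smul_add_smul (contMDiff_comp_mul hγ.1 c)
    (hγ.2.comp_mul hγ.1 c) c 0
  have heq : (fun s ↦ c • velocity (E := E) γ (c * s) + (0 : ℝ) • velocity (E := E) γ (c * s)) =
      velocity (E := E) (fun s ↦ γ (c * s)) := by
    funext s
    rw [zero_smul, add_zero, velocity_comp_mul c s (hγ.1.contMDiffAt.mdifferentiableAt (by simp))]
  rw [heq] at h
  exact h

theorem inner_grad {E M : Type*} [NormedAddCommGroup E] [NormedSpace ℝ E] [FiniteDimensional ℝ E]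
    [TopologicalSpace M] [ChartedSpace E M] [IsManifold 𝓘(ℝ, E) ∞ M]
    [RiemannianBundle (fun x : M ↦ TangentSpace 𝓘(ℝ, E) x)] (f : M → ℝ) (x : M)
    (v : TangentSpace 𝓘(ℝ, E) x) :
    (inner ℝ (grad f x) v : ℝ) = mfderiv 𝓘(ℝ, E) 𝓘(ℝ, ℝ) f x v := by
  have : FiniteDimensional ℝ (TangentSpace 𝓘(ℝ, E) x) := inferInstanceAs (FiniteDimensional ℝ E)
  have : CompleteSpace (TangentSpace 𝓘(ℝ, E) x) := FiniteDimensional.complete ℝ _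
  exact InnerProductSpace.toDual_symm_apply

/-- Smoothness compares times $0$ and $1$ only; it is applied to $s\mapsto\gamma(ts)$, a geodesic of
initial speed $t\|\gamma'(0)\|$. -/
theorem GeodesicallySmooth.norm_sub_le_mul (hf : GeodesicallySmooth E L f)
    (hγ : IsGeodesic (E := E) γ) {V : ∀ t, TangentSpace 𝓘(ℝ, E) (γ t)}
    (hV : IsParallelAlong γ V) {t : ℝ} (ht : 0 ≤ t) (h1 : V t = grad f (γ t)) :
    ‖grad f (γ 0) - V 0‖ ≤ L * (t * ‖velocity (E := E) γ 0‖) := by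
  have key : ∀ r, r = t → V r = grad f (γ r) := by rintro r rfl; exact h1
  have h := hf.norm_sub_le (hγ.comp_mul t) (hV.comp_mul hγ.1 t) (key _ (mul_one t))
  rw [velocity_comp_mul t 0 (hγ.1.contMDiffAt.mdifferentiableAt (by simp)), norm_smul,
    Real.norm_of_nonneg ht] at h
  have key2 : ∀ r, r = 0 → ‖grad f (γ r) - V r‖ ≤ L * (t * ‖velocity (E := E) γ r‖) →
      ‖grad f (γ 0) - V 0‖ ≤ L * (t * ‖velocity (E := E) γ 0‖) := by
    rintro r rfl h; exact h
  exact key2 _ (mul_zero t) h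

/-- A geodesically smooth function lies below its quadratic upper model along geodesics. -/
theorem GeodesicallySmooth.apply_one_le (hf : GeodesicallySmooth E L f)
    (hγ : IsGeodesic (E := E) γ) :
    f (γ 1) ≤ f (γ 0) + inner ℝ (grad f (γ 0)) (velocity (E := E) γ 0)
      + L / 2 * ‖velocity (E := E) γ 0‖ ^ 2 := by
  set m : ℝ := inner ℝ (grad f (γ 0)) (velocity (E := E) γ 0) with hm
  set n : ℝ := ‖velocity (E := E) γ 0‖ with hn
  have hd : ∀ t, HasDerivAt (fun s ↦ f (γ s))
      (inner ℝ (grad f (γ t)) (velocity (E := E) γ t) : ℝ) t := by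
    intro t
    have hγt : MDifferentiableAt 𝓘(ℝ, ℝ) 𝓘(ℝ, E) γ t := hγ.1.contMDiffAt.mdifferentiableAt (by simp)
    have h := (hf.1 (γ t)).hasMFDerivAt.comp t hγt.hasMFDerivAt
    let A : ℝ →L[ℝ] ℝ := (mfderiv 𝓘(ℝ, E) 𝓘(ℝ, ℝ) f (γ t)).comp (mfderiv 𝓘(ℝ, ℝ) 𝓘(ℝ, E) γ t)
    have h' : HasFDerivAt (fun s ↦ f (γ s)) A t := hasMFDerivAt_iff_hasFDerivAt.1 h
    rw [inner_grad]
    exact h'.hasDerivAt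
  have hbound : ∀ t, 0 ≤ t → (inner ℝ (grad f (γ t)) (velocity (E := E) γ t) : ℝ)
      ≤ m + L * t * n ^ 2 := by
    intro t ht
    -- Both $V$ and the velocity are parallel, so their inner product at time $t$ can be computed at
    -- time $0$, where smoothness compares $V(0)$ with the gradient.
    obtain ⟨V, hV, hVt⟩ := exists_isParallelAlong hγ.1 t (grad f (γ t))
    rw [← hVt, hV.inner_eq hγ.1 hγ.2 t 0]
    have h1 := hf.norm_sub_le_mul hγ hV ht hVt
    have h2 : (inner ℝ (V 0 - grad f (γ 0)) (velocity (E := E) γ 0) : ℝ) ≤ L * (t * n) * n := by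
      refine (real_inner_le_norm _ _).trans ?_
      rw [norm_sub_rev]
      gcongr
    rw [inner_sub_left] at h2
    linarith
  let ψ : ℝ → ℝ := fun t ↦ f (γ t) - (m * t + L / 2 * n ^ 2 * t ^ 2)
  have hψ : ∀ t, HasDerivAt ψ ((inner ℝ (grad f (γ t)) (velocity (E := E) γ t) : ℝ)
      - (m + L * t * n ^ 2)) t := by
    intro t
    refine (hd t).sub ?_
    have := ((hasDerivAt_id t).const_mul m).add
      (((hasDerivAt_id t).pow 2).const_mul (L / 2 * n ^ 2))
    refine this.congr_deriv ?_
    simp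
    ring
  have hanti : AntitoneOn ψ (Icc 0 1) := by
    refine antitoneOn_of_deriv_nonpos (convex_Icc 0 1)
      (fun t _ ↦ (hψ t).continuousAt.continuousWithinAt)
      (fun t _ ↦ (hψ t).differentiableAt.differentiableWithinAt) fun t ht ↦ ?_
    rw [interior_Icc] at ht
    rw [(hψ t).deriv]
    linarith [hbound t ht.1.le]
  have := hanti (left_mem_Icc.2 zero_le_one) (right_mem_Icc.2 zero_le_one) zero_le_one
  simp only [ψ] at this
  linarith

/-- Parallel transport along the geodesic with given initial data. -/
theorem IsGeodesicFrom.exists_transport {x : M} {v : TangentSpace 𝓘(ℝ, E) x}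
    (hγ : IsGeodesicFrom x v γ) :
    ∃ T : TangentSpace 𝓘(ℝ, E) x ≃ₗᵢ[ℝ] TangentSpace 𝓘(ℝ, E) (γ 1),
      (∀ u w, IsParallelTransport γ 0 1 ⟨x, u⟩ ⟨γ 1, w⟩ ↔ w = T u) ∧
      ∀ (L : ℝ) (f : M → ℝ), GeodesicallySmooth E L f →
        ‖grad f (γ 1) - T (grad f x)‖ ≤ L * ‖v‖ ∧
        f (γ 1) ≤ f x + inner ℝ (grad f x) v + L / 2 * ‖v‖ ^ 2 := by
  obtain ⟨hg, heq⟩ := hγ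
  -- Replacing $x$ by $\gamma(0)$ and $v$ by $\gamma'(0)$ removes every dependent cast between
  -- tangent spaces.
  obtain ⟨rfl, h⟩ := TotalSpace.mk.inj heq
  obtain rfl := eq_of_heq h
  obtain ⟨T, hT⟩ := exists_linearIsometryEquiv_transport (E := E) hg.1 0 1
  refine ⟨T, fun u w ↦ ⟨?_, ?_⟩, fun L f hf ↦ ⟨?_, hf.apply_one_le hg⟩⟩
  · rintro ⟨V, hV, h0, h1⟩
    rw [← TotalSpace.mk_injective (F := E) _ h0, hT V hV, ← TotalSpace.mk_injective (F := E) _ h1]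
  · rintro rfl
    obtain ⟨V, hV, h0⟩ := exists_isParallelAlong hg.1 0 u
    refine ⟨V, hV, by rw [h0], ?_⟩
    rw [← hT V hV, h0]
  · obtain ⟨V, hV, h1⟩ := exists_isParallelAlong hg.1 1 (grad f (γ 1))
    have := hf.norm_sub_le hg hV h1
    rwa [← h1, ← hT V hV, ← map_sub, LinearIsometryEquiv.norm_map, norm_sub_rev]

/-- Completeness excludes the junk values of `geodesic` and `expTransport`, and uniqueness of
transport identifies the chosen vector with $Tu$. This is the only interface to the geometry used in
the analysis of one step. -/
theorem exists_expTransport (hM : GeodesicallyComplete E M) (x : M) (v : TangentSpace 𝓘(ℝ, E) x) :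
    ∃ T : TangentSpace 𝓘(ℝ, E) x ≃ₗᵢ[ℝ] TangentSpace 𝓘(ℝ, E) (expMap x v),
      (∀ u, expTransport x v u = T u) ∧
      ∀ (L : ℝ) (f : M → ℝ), GeodesicallySmooth E L f →
        ‖grad f (expMap x v) - T (grad f x)‖ ≤ L * ‖v‖ ∧
        f (expMap x v) ≤ f x + inner ℝ (grad f x) v + L / 2 * ‖v‖ ^ 2 := by
  have hγ : IsGeodesicFrom x v (geodesic x v) := by
    rw [geodesic, dif_pos (hM x v)]
    exact (hM x v).choose_spec
  obtain ⟨T, hT, hf⟩ := hγ.exists_transport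
  refine ⟨T, fun u ↦ ?_, hf⟩
  have hex : ∃ w : TangentSpace 𝓘(ℝ, E) (expMap x v),
      IsParallelTransport (geodesic x v) 0 1 ⟨x, u⟩ ⟨expMap x v, w⟩ := ⟨T u, (hT u (T u)).2 rfl⟩
  rw [expTransport, dif_pos hex]
  exact (hT u _).1 hex.choose_spec

/-- The objective of an online problem inherits geodesic smoothness from the samples. -/
theorem GeodesicallySmooth.objective {Ξ : Type*} [MeasurableSpace Ξ] {D : Measure Ξ}
    [IsProbabilityMeasure D] {F : M → Ξ → ℝ}
    (hf : MDifferentiable 𝓘(ℝ, E) 𝓘(ℝ, ℝ) (objective D F))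
    (hunb : ∀ x : M, Integrable (fun ξ ↦ (stochGrad F x ξ : TangentSpace 𝓘(ℝ, E) x)) D ∧
      ∫ ξ, (stochGrad F x ξ : TangentSpace 𝓘(ℝ, E) x) ∂D = grad (RPage.objective D F) x)
    (hsmooth : ∀ ξ, GeodesicallySmooth E L (fun x ↦ F x ξ)) :
    GeodesicallySmooth E L (RPage.objective D F) := by
  refine ⟨hf, fun γ hγ w ⟨V, hV, h1, h0⟩ ↦ ?_⟩
  have h1 := TotalSpace.mk_injective (F := E) _ h1
  obtain rfl := TotalSpace.mk_injective (F := E) _ h0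
  obtain ⟨T, hT⟩ := exists_linearIsometryEquiv_transport (E := E) hγ.1 1 0
  have hint : Integrable (fun ξ ↦ T (stochGrad F (γ 1) ξ)) D :=
    T.toContinuousLinearEquiv.toContinuousLinearMap.integrable_comp (hunb (γ 1)).1
  -- Transport is a continuous linear map, so it passes under the expectation; the bound for each
  -- sample then survives averaging.
  have hTint : ∫ ξ, T (stochGrad F (γ 1) ξ) ∂D = V 0 := by
    rw [← hT V hV, h1, ← (hunb (γ 1)).2]
    exact T.toContinuousLinearEquiv.integral_comp_comm _
  rw [← hTint, ← (hunb (γ 0)).2, ← integral_sub (hunb (γ 0)).1 hint]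
  have hle : ∀ ξ, ‖stochGrad F (γ 0) ξ - T (stochGrad F (γ 1) ξ)‖
      ≤ L * ‖velocity (E := E) γ 0‖ := by
    intro ξ
    obtain ⟨W, hW, hW1⟩ := exists_isParallelAlong hγ.1 1 (stochGrad F (γ 1) ξ)
    have := (hsmooth ξ).norm_sub_le hγ hW hW1
    rwa [← hT W hW, hW1] at this
  simpa using norm_integral_le_of_norm_le_const (μ := D) (Eventually.of_forall hle)

end Geodesics

/-! ### Borel measurability of gradient quantities -/

section Measurability

open Set Topology Filter

theorem measurable_of_countable_cover {X Y ι : Type*} [MeasurableSpace X] [MeasurableSpace Y]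
    {f : X → Y} {I : Set ι} (hI : I.Countable) {U : ι → Set X} (hU : ∀ i, MeasurableSet (U i))
    (hcov : ⋃ i ∈ I, U i = univ) (hf : ∀ i, Measurable ((U i).domRestrict f)) : Measurable f := by
  intro S hS
  have : f ⁻¹' S = ⋃ i ∈ I, Subtype.val '' ((U i).domRestrict f ⁻¹' S) := by
    ext x
    have hx : x ∈ ⋃ i ∈ I, U i := hcov ▸ mem_univ x
    simp only [mem_iUnion] at hx
    simp only [mem_preimage, mem_iUnion, mem_image, Subtype.exists, domRestrict_apply]
    constructor
    · intro h
      obtain ⟨i, hi, hxi⟩ := hx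
      exact ⟨i, hi, x, hxi, h, rfl⟩
    · rintro ⟨i, -, y, hyi, hy, rfl⟩
      exact hy
  rw [this]
  exact MeasurableSet.biUnion hI fun i _ ↦ (hU i).subtype_image (hf i hS)

variable {E : Type*} [NormedAddCommGroup E] {M : Type*} [TopologicalSpace M] [ChartedSpace E M]

theorem exists_countable_chart_cover [SecondCountableTopology M] :
    ∃ I : Set M, I.Countable ∧ ⋃ z ∈ I, (chartAt E z).source = univ := by
  obtain ⟨I, hI, hcov⟩ := TopologicalSpace.countable_cover_nhds
    (fun z : M ↦ chart_source_mem_nhds E z)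
  exact ⟨I, hI, hcov⟩

variable [NormedSpace ℝ E] [IsManifold 𝓘(ℝ, E) ∞ M] {f : M → ℝ}

theorem mfderiv_eq_fderiv_toCoord (hf : MDifferentiable 𝓘(ℝ, E) 𝓘(ℝ, ℝ) f) {z q : M}
    (hq : q ∈ (chartAt E z).source) (v : TangentSpace 𝓘(ℝ, E) q) :
    mfderiv 𝓘(ℝ, E) 𝓘(ℝ, ℝ) f q v =
      fderiv ℝ (f ∘ (extChartAt 𝓘(ℝ, E) z).symm) (extChartAt 𝓘(ℝ, E) z q) (toCoord z q v) := by
  have hq' : q ∈ (extChartAt 𝓘(ℝ, E) z).source := by rwa [extChartAt_source]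
  have hs : MDifferentiableAt 𝓘(ℝ, E) 𝓘(ℝ, E) (extChartAt 𝓘(ℝ, E) z).symm
      (extChartAt 𝓘(ℝ, E) z q) := by
    have := mdifferentiableWithinAt_extChartAt_symm (I := 𝓘(ℝ, E))
      ((extChartAt 𝓘(ℝ, E) z).map_source hq')
    rwa [𝓘(ℝ, E).range_eq_univ, mdifferentiableWithinAt_univ] at this
  have hh : DifferentiableAt ℝ (f ∘ (extChartAt 𝓘(ℝ, E) z).symm) (extChartAt 𝓘(ℝ, E) z q) :=
    mdifferentiableAt_iff_differentiableAt.1 ((hf _).comp _ hs)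
  have h2 := hh.hasFDerivAt.hasMFDerivAt.comp q (hasMFDerivAt_extChartAt_toCoord hq)
  have h3 : (f ∘ (extChartAt 𝓘(ℝ, E) z).symm) ∘ extChartAt 𝓘(ℝ, E) z =ᶠ[𝓝 q] f := by
    filter_upwards [(chartAt E z).open_source.mem_nhds hq] with x hx
    simp only [Function.comp_apply]
    rw [(extChartAt 𝓘(ℝ, E) z).left_inv (by rwa [extChartAt_source])]
  rw [(h2.congr_of_eventuallyEq h3.symm).mfderiv]
  rfl

variable [FiniteDimensional ℝ E] [RiemannianBundle (fun x : M ↦ TangentSpace 𝓘(ℝ, E) x)]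

theorem inner_grad_eq_fderiv (hf : MDifferentiable 𝓘(ℝ, E) 𝓘(ℝ, ℝ) f) {z q : M}
    (hq : q ∈ (chartAt E z).source) (v : TangentSpace 𝓘(ℝ, E) q) :
    (inner ℝ (grad f q) v : ℝ) =
      fderiv ℝ (f ∘ (extChartAt 𝓘(ℝ, E) z).symm) (extChartAt 𝓘(ℝ, E) z q) (toCoord z q v) :=
  (inner_grad f q v).trans (mfderiv_eq_fderiv_toCoord hf hq v)

/-- The gradient need not be continuous. In a chart the pairing is a Fréchet derivative evaluated at
a vector, and derivatives are always measurable in the base point; second countability leaves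
countably many charts to treat. -/
theorem measurable_inner_grad [SecondCountableTopology M]
    (hf : MDifferentiable 𝓘(ℝ, E) 𝓘(ℝ, ℝ) f) :
    Measurable[borel (TangentBundle 𝓘(ℝ, E) M)]
      (fun z : TangentBundle 𝓘(ℝ, E) M ↦ (inner ℝ (grad f z.1) z.2 : ℝ)) := by
  let : MeasurableSpace (TangentBundle 𝓘(ℝ, E) M) := borel _
  have : BorelSpace (TangentBundle 𝓘(ℝ, E) M) := ⟨rfl⟩
  let : MeasurableSpace E := borel E
  have : BorelSpace E := ⟨rfl⟩
  obtain ⟨I, hI, hcov⟩ := exists_countable_chart_cover (E := E) (M := M)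
  have hopen : ∀ z : M, IsOpen ((fun w : TangentBundle 𝓘(ℝ, E) M ↦ w.1) ⁻¹'
      (chartAt E z).source) := fun z ↦
    (chartAt E z).open_source.preimage (FiberBundle.continuous_proj E (TangentSpace 𝓘(ℝ, E)))
  refine measurable_of_countable_cover hI
    (U := fun z ↦ (fun w : TangentBundle 𝓘(ℝ, E) M ↦ w.1) ⁻¹' (chartAt E z).source)
    (fun z ↦ (hopen z).measurableSet) ?_ fun z ↦ ?_
  · rw [← preimage_iUnion₂, hcov, preimage_univ]
  · have hc : ContinuousOn (fun w : TangentBundle 𝓘(ℝ, E) M ↦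
        ((extChartAt 𝓘(ℝ, E) z w.1, (trivializationAt E (TangentSpace 𝓘(ℝ, E)) z w).2) : E × E))
        ((fun w : TangentBundle 𝓘(ℝ, E) M ↦ w.1) ⁻¹' (chartAt E z).source) := by
      refine ContinuousOn.prodMk ?_ ?_
      · refine ContinuousOn.comp (continuousOn_extChartAt z)
          (FiberBundle.continuous_proj E (TangentSpace 𝓘(ℝ, E))).continuousOn ?_
        intro w hw
        rwa [extChartAt_source]
      · exact (trivializationAt E (TangentSpace 𝓘(ℝ, E)) z).continuousOn.snd
    have hm : Measurable fun p : E × E ↦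
        fderiv ℝ (f ∘ (extChartAt 𝓘(ℝ, E) z).symm) p.1 p.2 :=
      ContinuousLinearMap.measurable_apply₂.comp
        (((measurable_fderiv ℝ _).comp measurable_fst).prodMk measurable_snd)
    have := hm.comp hc.domRestrict.measurable
    convert this using 1
    funext w
    simp only [domRestrict_apply, Function.comp_apply]
    have hw : w.1.1 ∈ (chartAt E z).source := w.2
    rw [inner_grad_eq_fderiv hf hw, ← toCoord_apply hw]

/-- Completing the square, $\|\nabla f\|^2=\sup_v(2\langle\nabla f,v\rangle-\|v\|^2)$, and by
continuity a countable dense set of coordinate vectors suffices. This turns measurability of the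
norm into countably many scalar conditions. -/
theorem norm_grad_sq_le_iff {z q : M} (hq : q ∈ (chartAt E z).source) (c : ℝ) :
    ‖grad (E := E) f q‖ ^ 2 ≤ c ↔ ∀ n : ℕ,
      2 * (inner ℝ (grad f q) (ofCoord z q (TopologicalSpace.denseSeq E n)) : ℝ)
        - ‖ofCoord z q (TopologicalSpace.denseSeq E n)‖ ^ 2 ≤ c := by
  have key : ∀ v : TangentSpace 𝓘(ℝ, E) q,
      2 * (inner ℝ (grad f q) v : ℝ) - ‖v‖ ^ 2
        = ‖grad (E := E) f q‖ ^ 2 - ‖grad (E := E) f q - v‖ ^ 2 := by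
    intro v
    rw [norm_sub_sq_real]
    ring
  simp only [key]
  constructor
  · intro h n
    exact (sub_le_self _ (sq_nonneg _)).trans h
  · intro h
    have hclosed : IsClosed {a : E | ‖grad (E := E) f q‖ ^ 2
        - ‖grad (E := E) f q - ofCoord z q a‖ ^ 2 ≤ c} :=
      isClosed_le (by fun_prop) continuous_const
    have huniv : ∀ a : E, ‖grad (E := E) f q‖ ^ 2
        - ‖grad (E := E) f q - ofCoord z q a‖ ^ 2 ≤ c := by
      intro a
      refine (TopologicalSpace.denseRange_denseSeq E).induction_on a hclosed h
    have := huniv (toCoord z q (grad f q))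
    rw [ofCoord_toCoord hq] at this
    simpa using this

variable [IsContMDiffRiemannianBundle 𝓘(ℝ, E) ∞ E (fun x : M ↦ TangentSpace 𝓘(ℝ, E) x)]

theorem measurable_norm_grad_sq [SecondCountableTopology M]
    (hf : MDifferentiable 𝓘(ℝ, E) 𝓘(ℝ, ℝ) f) :
    Measurable[borel M] (fun x : M ↦ ‖grad (E := E) f x‖ ^ 2) := by
  let : MeasurableSpace M := borel _
  have : BorelSpace M := ⟨rfl⟩
  let : MeasurableSpace E := borel E
  have : BorelSpace E := ⟨rfl⟩
  obtain ⟨I, hI, hcov⟩ := exists_countable_chart_cover (E := E) (M := M)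
  refine measurable_of_countable_cover hI (fun z ↦ (chartAt E z).open_source.measurableSet) hcov
    fun z ↦ ?_
  refine measurable_of_Iic fun c ↦ ?_
  have heq : ((chartAt E z).source.domRestrict fun x : M ↦ ‖grad (E := E) f x‖ ^ 2) ⁻¹' Iic c =
      ⋂ n : ℕ, {q : (chartAt E z).source |
        2 * fderiv ℝ (f ∘ (extChartAt 𝓘(ℝ, E) z).symm) (extChartAt 𝓘(ℝ, E) z q)
            (TopologicalSpace.denseSeq E n)
          - (inner ℝ (ofCoord z q.1 (TopologicalSpace.denseSeq E n))
            (ofCoord z q.1 (TopologicalSpace.denseSeq E n)) : ℝ) ≤ c} := by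
    ext q
    rw [mem_preimage, domRestrict_apply, mem_Iic, norm_grad_sq_le_iff q.2]
    simp only [mem_iInter, mem_ofPred_eq, inner_grad_eq_fderiv hf q.2, toCoord_ofCoord q.2,
      real_inner_self_eq_norm_sq]
  rw [heq]
  refine MeasurableSet.iInter fun n ↦ measurableSet_le (Measurable.sub (Measurable.const_mul ?_ 2) ?_)
    measurable_const
  · have hc : ContinuousOn (extChartAt 𝓘(ℝ, E) z) (chartAt E z).source := by
      rw [← extChartAt_source 𝓘(ℝ, E)]
      exact continuousOn_extChartAt z
    exact (measurable_fderiv_apply_const ℝ _ _).comp hc.domRestrict.measurable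
  · exact (contMDiffOn_inner_ofCoord z _ _).continuousOn.domRestrict.measurable

theorem continuous_norm_sq_snd {E M : Type*} [NormedAddCommGroup E] [NormedSpace ℝ E]
    [TopologicalSpace M] [ChartedSpace E M] [IsManifold 𝓘(ℝ, E) ∞ M]
    [RiemannianBundle (fun x : M ↦ TangentSpace 𝓘(ℝ, E) x)]
    [IsContMDiffRiemannianBundle 𝓘(ℝ, E) ∞ E (fun x : M ↦ TangentSpace 𝓘(ℝ, E) x)] :
    Continuous (fun z : TangentBundle 𝓘(ℝ, E) M ↦ ‖(z.2 : TangentSpace 𝓘(ℝ, E) z.1)‖ ^ 2) := by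
  have h := ContMDiff.inner_bundle (F := E) (E := fun x : M ↦ TangentSpace 𝓘(ℝ, E) x)
    (n := ∞) (IB := 𝓘(ℝ, E)) (IM := 𝓘(ℝ, E).tangent)
    (b := fun z : TangentBundle 𝓘(ℝ, E) M ↦ z.1) (v := fun z ↦ z.2) (w := fun z ↦ z.2)
    contMDiff_id contMDiff_id
  simp only [real_inner_self_eq_norm_sq] at h
  exact h.continuous

theorem measurable_norm_sub_grad_sq [SecondCountableTopology M]
    (hf : MDifferentiable 𝓘(ℝ, E) 𝓘(ℝ, ℝ) f) :
    Measurable[borel (TangentBundle 𝓘(ℝ, E) M)]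
      (fun z : TangentBundle 𝓘(ℝ, E) M ↦
        ‖(z.2 : TangentSpace 𝓘(ℝ, E) z.1) - grad f z.1‖ ^ 2) := by
  let : MeasurableSpace (TangentBundle 𝓘(ℝ, E) M) := borel _
  have : BorelSpace (TangentBundle 𝓘(ℝ, E) M) := ⟨rfl⟩
  let : MeasurableSpace M := borel _
  have : BorelSpace M := ⟨rfl⟩
  -- Vectors in varying fibres cannot be subtracted as maps into one space, so the square is
  -- expanded into three scalar functions, each already measurable.
  have heq : (fun z : TangentBundle 𝓘(ℝ, E) M ↦
      ‖(z.2 : TangentSpace 𝓘(ℝ, E) z.1) - grad f z.1‖ ^ 2) =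
      fun z : TangentBundle 𝓘(ℝ, E) M ↦ ‖(z.2 : TangentSpace 𝓘(ℝ, E) z.1)‖ ^ 2
        - 2 * (inner ℝ (grad f z.1) z.2 : ℝ) + ‖grad (E := E) f z.1‖ ^ 2 := by
    funext z
    rw [norm_sub_sq_real, real_inner_comm]
  rw [heq]
  exact (continuous_norm_sq_snd.measurable.sub ((measurable_inner_grad hf).const_mul 2)).add
    ((measurable_norm_grad_sq hf).comp
      (FiberBundle.continuous_proj E (TangentSpace 𝓘(ℝ, E))).measurable)

end Measurability

/-! ### Variance of minibatch averages -/

section Variance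

variable {Ξ : Type*} [MeasurableSpace Ξ] {D : Measure Ξ} [IsProbabilityMeasure D]
  {H : Type*} [NormedAddCommGroup H] [InnerProductSpace ℝ H]

theorem measurePreserving_pair {n : ℕ} {i j : Fin n} (hij : i ≠ j) :
    MeasurePreserving (fun ξ : Fin n → Ξ ↦ (ξ i, ξ j)) (Measure.pi fun _ ↦ D) (D.prod D) := by
  have hind : iIndepFun (fun (i : Fin n) (ξ : Fin n → Ξ) ↦ ξ i) (Measure.pi fun _ ↦ D) :=
    iIndepFun_pi (X := fun _ ↦ id) fun _ ↦ aemeasurable_id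
  refine ⟨by fun_prop, ?_⟩
  rw [(indepFun_iff_map_prod_eq_prod_map_map
    (measurable_pi_apply i).aemeasurable (measurable_pi_apply j).aemeasurable).1
    (hind.indepFun hij)]
  have h : ∀ i : Fin n, Measure.map (fun ξ : Fin n → Ξ ↦ ξ i) (Measure.pi fun _ ↦ D) = D :=
    fun i ↦ (measurePreserving_eval (fun _ : Fin n ↦ D) i).map_eq
  rw [h, h]

variable {Z : Ξ → H}

theorem integrable_inner_of_sq {Ω : Type*} [MeasurableSpace Ω] {μ : Measure Ω} {X Y : Ω → H}
    (hX : AEStronglyMeasurable X μ) (hY : AEStronglyMeasurable Y μ)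
    (hX2 : Integrable (fun t ↦ ‖X t‖ ^ 2) μ) (hY2 : Integrable (fun t ↦ ‖Y t‖ ^ 2) μ) :
    Integrable (fun t ↦ (inner ℝ (X t) (Y t) : ℝ)) μ := by
  refine (hX2.add hY2).mono' (hX.inner hY) (Filter.Eventually.of_forall fun t ↦ ?_)
  have h1 := norm_inner_le_norm (𝕜 := ℝ) (X t) (Y t)
  simp only [Pi.add_apply]
  nlinarith [sq_nonneg (‖X t‖ - ‖Y t‖), sq_nonneg ‖X t‖, sq_nonneg ‖Y t‖]

variable [CompleteSpace H]

/-- Distinct coordinates have law $D\otimes D$; by Fubini the inner integral is the pairing of a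
fixed vector with the mean, which is zero. This is what gains the factor $1/n$. -/
theorem integral_inner_pair {n : ℕ} {i j : Fin n} (hij : i ≠ j) (hZ : Integrable Z D)
    (hZ0 : ∫ ξ, Z ξ ∂D = 0) (hZ2 : Integrable (fun ξ ↦ ‖Z ξ‖ ^ 2) D) :
    ∫ ξ : Fin n → Ξ, (inner ℝ (Z (ξ i)) (Z (ξ j)) : ℝ) ∂(Measure.pi fun _ ↦ D) = 0 := by
  have hint : Integrable (fun p : Ξ × Ξ ↦ (inner ℝ (Z p.1) (Z p.2) : ℝ)) (D.prod D) :=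
    integrable_inner_of_sq hZ.aestronglyMeasurable.comp_fst hZ.aestronglyMeasurable.comp_snd
      (hZ2.comp_fst D) (hZ2.comp_snd D)
  have hmp := measurePreserving_pair (D := D) hij
  have h := integral_map (μ := Measure.pi fun _ : Fin n ↦ D) hmp.aemeasurable
    (f := fun p : Ξ × Ξ ↦ (inner ℝ (Z p.1) (Z p.2) : ℝ))
    (by rw [hmp.map_eq]; exact hint.aestronglyMeasurable)
  rw [hmp.map_eq, integral_prod _ hint] at h
  rw [← h]
  simp only [integral_inner hZ, hZ0, inner_zero_right, integral_zero]

/-- The second moment of a shifted average of independent copies of a centred random vector. -/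
theorem integral_norm_add_average_sq {n : ℕ} (hn : 0 < n) (hZ : Integrable Z D)
    (hZ0 : ∫ ξ, Z ξ ∂D = 0) (hZ2 : Integrable (fun ξ ↦ ‖Z ξ‖ ^ 2) D) (a : H) :
    Integrable (fun ξ : Fin n → Ξ ↦ ‖a + (1 / n : ℝ) • ∑ i, Z (ξ i)‖ ^ 2)
        (Measure.pi fun _ ↦ D) ∧
      ∫ ξ : Fin n → Ξ, ‖a + (1 / n : ℝ) • ∑ i, Z (ξ i)‖ ^ 2 ∂(Measure.pi fun _ ↦ D)
        = ‖a‖ ^ 2 + (∫ ξ, ‖Z ξ‖ ^ 2 ∂D) / n := by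
  have heval := fun i : Fin n ↦ measurePreserving_eval (fun _ : Fin n ↦ D) i
  have hZi : ∀ i : Fin n, Integrable (fun ξ : Fin n → Ξ ↦ Z (ξ i)) (Measure.pi fun _ ↦ D) :=
    fun i ↦ (heval i).integrable_comp_of_integrable hZ
  have hZi2 : ∀ i : Fin n, Integrable (fun ξ : Fin n → Ξ ↦ ‖Z (ξ i)‖ ^ 2)
      (Measure.pi fun _ ↦ D) := fun i ↦ (heval i).integrable_comp_of_integrable hZ2
  have hin : ∀ i j : Fin n, Integrable
      (fun ξ : Fin n → Ξ ↦ (inner ℝ (Z (ξ i)) (Z (ξ j)) : ℝ)) (Measure.pi fun _ ↦ D) :=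
    fun i j ↦ integrable_inner_of_sq (hZi i).aestronglyMeasurable (hZi j).aestronglyMeasurable
      (hZi2 i) (hZi2 j)
  have hia : ∀ i : Fin n, Integrable (fun ξ : Fin n → Ξ ↦ (inner ℝ a (Z (ξ i)) : ℝ))
      (Measure.pi fun _ ↦ D) := fun i ↦ (hZi i).const_inner a
  have hia0 : ∀ i : Fin n,
      ∫ ξ : Fin n → Ξ, (inner ℝ a (Z (ξ i)) : ℝ) ∂(Measure.pi fun _ ↦ D) = 0 := by
    intro i
    have h := integral_map (μ := Measure.pi fun _ : Fin n ↦ D) (heval i).aemeasurable (f := Z)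
      (by rw [(heval i).map_eq]; exact hZ.aestronglyMeasurable)
    rw [(heval i).map_eq, hZ0] at h
    rw [integral_inner (hZi i)]
    change inner ℝ a (∫ ξ : Fin n → Ξ, Z (Function.eval i ξ) ∂_) = 0
    rw [← h, inner_zero_right]
  have hdiag : ∀ i : Fin n, ∫ ξ : Fin n → Ξ, (inner ℝ (Z (ξ i)) (Z (ξ i)) : ℝ)
      ∂(Measure.pi fun _ ↦ D) = ∫ ξ, ‖Z ξ‖ ^ 2 ∂D := by
    intro i
    have h := integral_map (μ := Measure.pi fun _ : Fin n ↦ D) (heval i).aemeasurable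
      (f := fun ξ ↦ ‖Z ξ‖ ^ 2) (by rw [(heval i).map_eq]; exact hZ2.aestronglyMeasurable)
    rw [(heval i).map_eq] at h
    simp only [real_inner_self_eq_norm_sq]
    exact h.symm
  have hexp : (fun ξ : Fin n → Ξ ↦ ‖a + (1 / n : ℝ) • ∑ i, Z (ξ i)‖ ^ 2) =
      fun ξ ↦ ‖a‖ ^ 2 + 2 * (1 / n : ℝ) * ∑ i, (inner ℝ a (Z (ξ i)) : ℝ)
        + (1 / n : ℝ) ^ 2 * ∑ i, ∑ j, (inner ℝ (Z (ξ i)) (Z (ξ j)) : ℝ) := by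
    funext ξ
    rw [norm_add_sq_real, norm_smul, mul_pow, ← real_inner_self_eq_norm_sq (∑ i, Z (ξ i)),
      inner_smul_right, inner_sum, Real.norm_eq_abs, sq_abs, sum_inner]
    simp only [inner_sum]
    ring
  have h1 : Integrable (fun ξ : Fin n → Ξ ↦ 2 * (1 / n : ℝ) * ∑ i, (inner ℝ a (Z (ξ i)) : ℝ))
      (Measure.pi fun _ ↦ D) := (integrable_finsetSum _ fun i _ ↦ hia i).const_mul _
  have h2 : Integrable (fun ξ : Fin n → Ξ ↦
      (1 / n : ℝ) ^ 2 * ∑ i, ∑ j, (inner ℝ (Z (ξ i)) (Z (ξ j)) : ℝ)) (Measure.pi fun _ ↦ D) :=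
    (integrable_finsetSum _ fun i _ ↦ integrable_finsetSum _ fun j _ ↦ hin i j).const_mul _
  have h01 : Integrable (fun ξ : Fin n → Ξ ↦
      ‖a‖ ^ 2 + 2 * (1 / n : ℝ) * ∑ i, (inner ℝ a (Z (ξ i)) : ℝ)) (Measure.pi fun _ ↦ D) :=
    (integrable_const _).add h1
  rw [hexp]
  refine ⟨h01.add h2, ?_⟩
  rw [integral_add h01 h2, integral_add (integrable_const _) h1,
    integral_const_mul, integral_const_mul, integral_finsetSum _ fun i _ ↦ hia i,
    integral_finsetSum _ fun i _ ↦ integrable_finsetSum _ fun j _ ↦ hin i j]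
  have hsum : ∀ i : Fin n, ∫ ξ : Fin n → Ξ, ∑ j, (inner ℝ (Z (ξ i)) (Z (ξ j)) : ℝ)
      ∂(Measure.pi fun _ ↦ D) = ∫ ξ, ‖Z ξ‖ ^ 2 ∂D := by
    intro i
    rw [integral_finsetSum _ fun j _ ↦ hin i j, Finset.sum_eq_single i, hdiag]
    · intro j _ hj
      exact integral_inner_pair hj.symm hZ hZ0 hZ2
    · simp
  simp only [hia0, hsum, Finset.sum_const_zero, Finset.sum_const, Finset.card_univ,
    Fintype.card_fin, nsmul_eq_mul, integral_const, probReal_univ, one_smul]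
  have : (n : ℝ) ≠ 0 := by positivity
  field_simp
  ring

/-- The mean squared error of a shifted minibatch average. -/
theorem lintegral_norm_add_average_sub_sq_le {n : ℕ} (hn : 0 < n) {X : Ξ → H} {m : H}
    (hX : Integrable X D) (hm : ∫ ξ, X ξ ∂D = m) {v : ℝ}
    (hX2 : Integrable (fun ξ ↦ ‖X ξ - m‖ ^ 2) D) (hv : ∫ ξ, ‖X ξ - m‖ ^ 2 ∂D ≤ v) (a : H) :
    ∫⁻ ξ : Fin n → Ξ, ENNReal.ofReal (‖a + ((1 / n : ℝ) • ∑ i, X (ξ i)) - m‖ ^ 2)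
      ∂(Measure.pi fun _ ↦ D) ≤ ENNReal.ofReal (‖a‖ ^ 2 + v / n) := by
  have hZ : Integrable (fun ξ ↦ X ξ - m) D := hX.sub (integrable_const m)
  have hZ0 : ∫ ξ, (X ξ - m) ∂D = 0 := by
    rw [integral_sub hX (integrable_const m), hm]
    simp
  obtain ⟨hint, heq⟩ := integral_norm_add_average_sq hn hZ hZ0 hX2 a
  have hrw : ∀ ξ : Fin n → Ξ, a + ((1 / n : ℝ) • ∑ i, X (ξ i)) - m =
      a + (1 / n : ℝ) • ∑ i, (X (ξ i) - m) := by
    intro ξ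
    have : (n : ℝ) ≠ 0 := by positivity
    rw [Finset.sum_sub_distrib, Finset.sum_const, Finset.card_univ, Fintype.card_fin, smul_sub,
      ← Nat.cast_smul_eq_nsmul ℝ, smul_smul, one_div_mul_cancel this, one_smul, add_sub_assoc]
  simp only [hrw]
  rw [← ofReal_integral_eq_lintegral_ofReal hint
    (Filter.Eventually.of_forall fun _ ↦ sq_nonneg _), heq]
  gcongr

/-- The variance equals $\mathbb E\|X\|^2-\|m\|^2$, so centring does not worsen the constant $C^2$;
the triangle inequality would. -/
theorem integral_norm_sub_sq_le_of_bounded {X : Ξ → H} {m : H} (hX : Integrable X D)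
    (hm : ∫ ξ, X ξ ∂D = m) {C : ℝ} (hC : ∀ ξ, ‖X ξ‖ ≤ C) :
    Integrable (fun ξ ↦ ‖X ξ - m‖ ^ 2) D ∧ ∫ ξ, ‖X ξ - m‖ ^ 2 ∂D ≤ C ^ 2 := by
  have hsq : ∀ ξ, ‖X ξ‖ ^ 2 ≤ C ^ 2 := fun ξ ↦ pow_le_pow_left₀ (norm_nonneg _) (hC ξ) 2
  have hX2 : Integrable (fun ξ ↦ ‖X ξ‖ ^ 2) D :=
    (integrable_const (C ^ 2)).mono' (hX.aestronglyMeasurable.norm.pow 2)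
      (Filter.Eventually.of_forall fun ξ ↦ by simpa using hsq ξ)
  have hexp : (fun ξ ↦ ‖X ξ - m‖ ^ 2) =
      fun ξ ↦ ‖X ξ‖ ^ 2 - 2 * (inner ℝ m (X ξ) : ℝ) + ‖m‖ ^ 2 := by
    funext ξ
    rw [norm_sub_sq_real, real_inner_comm]
  have h1 : Integrable (fun ξ ↦ 2 * (inner ℝ m (X ξ) : ℝ)) D := (hX.const_inner m).const_mul 2
  have h12 : Integrable (fun ξ ↦ ‖X ξ‖ ^ 2 - 2 * (inner ℝ m (X ξ) : ℝ)) D := hX2.sub h1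
  rw [hexp]
  refine ⟨h12.add (integrable_const _), ?_⟩
  rw [integral_add h12 (integrable_const _), integral_sub hX2 h1, integral_const_mul,
    integral_inner hX, hm, real_inner_self_eq_norm_sq]
  have h2 : ∫ ξ, ‖X ξ‖ ^ 2 ∂D ≤ C ^ 2 := by
    simpa using integral_mono hX2 (integrable_const (C ^ 2)) hsq
  simp only [integral_const, probReal_univ, one_smul]
  nlinarith [sq_nonneg ‖m‖]

end Variance

/-! ### One iteration: error recursion and descent -/

section OneStep

variable {Ξ : Type*} [MeasurableSpace Ξ] {D : Measure Ξ} [IsProbabilityMeasure D] {B b : ℕ}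

instance isProbabilityMeasure_sampleLaw (p : unitInterval) :
    IsProbabilityMeasure (sampleLaw D B b p) := by
  unfold sampleLaw
  infer_instance

/-- Only an inequality, because neither function is assumed measurable: a lower integral over a
product is at most the iterated one, and an upper bound is all that is needed. -/
theorem lintegral_sampleLaw_ite_le (p : unitInterval) (h₁ : (Fin B → Ξ) → ENNReal)
    (h₂ : (Fin b → Ξ) → ENNReal) :
    ∫⁻ s, (if s.2.2 then h₁ s.1 else h₂ s.2.1) ∂(sampleLaw D B b p) ≤
      ENNReal.ofReal p * ∫⁻ ξ, h₁ ξ ∂(Measure.pi fun _ ↦ D)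
        + ENNReal.ofReal (1 - p) * ∫⁻ ξ, h₂ ξ ∂(Measure.pi fun _ ↦ D) := by
  have hcoin : ∀ a c : ENNReal, ∫⁻ t : Bool, (if t then a else c) ∂(bernoulliMeasure true false p) =
      ENNReal.ofReal p * a + ENNReal.ofReal (1 - p) * c := by
    intro a c
    have h1 : ((unitInterval.toNNReal p : NNReal) : ENNReal) = ENNReal.ofReal p := by
      rw [← unitInterval.coe_toNNReal p, ENNReal.ofReal_coe_nnreal]
    have h2 : ((unitInterval.toNNReal (unitInterval.symm p) : NNReal) : ENNReal) =
        ENNReal.ofReal (1 - p) := by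
      rw [← unitInterval.coe_symm_eq, ← unitInterval.coe_toNNReal (unitInterval.symm p),
        ENNReal.ofReal_coe_nnreal]
    rw [bernoulliMeasure_def, lintegral_add_measure]
    simp [lintegral_smul_measure, ENNReal.smul_def, h1, h2]
  calc ∫⁻ s, (if s.2.2 then h₁ s.1 else h₂ s.2.1) ∂(sampleLaw D B b p)
      ≤ ∫⁻ x, ∫⁻ y, (if y.2 then h₁ x else h₂ y.1)
          ∂((Measure.pi fun _ : Fin b ↦ D).prod (bernoulliMeasure true false p))
          ∂(Measure.pi fun _ : Fin B ↦ D) := lintegral_prod_le _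
    _ ≤ ∫⁻ x, ∫⁻ y, ∫⁻ t, (if t then h₁ x else h₂ y) ∂(bernoulliMeasure true false p)
          ∂(Measure.pi fun _ : Fin b ↦ D) ∂(Measure.pi fun _ : Fin B ↦ D) :=
        lintegral_mono fun x ↦ lintegral_prod_le _
    _ = _ := by
        simp only [hcoin, lintegral_add_left measurable_const, lintegral_add_right _ measurable_const,
          lintegral_const_mul' _ _ ENNReal.ofReal_ne_top, lintegral_const, measure_univ, mul_one]

variable {E : Type*} [NormedAddCommGroup E] [NormedSpace ℝ E] [FiniteDimensional ℝ E]
  {M : Type*} [TopologicalSpace M] [ChartedSpace E M] [IsManifold 𝓘(ℝ, E) ∞ M]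
  [RiemannianBundle (fun x : M ↦ TangentSpace 𝓘(ℝ, E) x)]

/-- The squared distance of a tangent vector to the gradient of `f`. -/
def gradError (f : M → ℝ) (z : TangentBundle 𝓘(ℝ, E) M) : ℝ :=
  ‖(z.2 : TangentSpace 𝓘(ℝ, E) z.1) - grad f z.1‖ ^ 2

variable {F : M → Ξ → ℝ} {σ : ℝ}

theorem lintegral_batchGrad_sub_sq_le {E M : Type*} [NormedAddCommGroup E] [NormedSpace ℝ E]
    [FiniteDimensional ℝ E] [TopologicalSpace M] [ChartedSpace E M]
    [RiemannianBundle (fun x : M ↦ TangentSpace 𝓘(ℝ, E) x)] {F : M → Ξ → ℝ} {x : M}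
    (hunb : Integrable (fun ξ ↦ (stochGrad F x ξ : TangentSpace 𝓘(ℝ, E) x)) D ∧
      ∫ ξ, (stochGrad F x ξ : TangentSpace 𝓘(ℝ, E) x) ∂D = grad (objective D F) x)
    (hvar : Integrable (fun ξ ↦ ‖(stochGrad F x ξ : TangentSpace 𝓘(ℝ, E) x)
        - grad (objective D F) x‖ ^ 2) D ∧
      ∫ ξ, ‖(stochGrad F x ξ : TangentSpace 𝓘(ℝ, E) x)
        - grad (objective D F) x‖ ^ 2 ∂D ≤ σ ^ 2) (hB : 0 < B) :
    ∫⁻ ξ : Fin B → Ξ, ENNReal.ofReal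
        (‖(batchGrad F ξ x : TangentSpace 𝓘(ℝ, E) x) - grad (objective D F) x‖ ^ 2)
      ∂(Measure.pi fun _ ↦ D) ≤ ENNReal.ofReal (σ ^ 2 / B) := by
  have : FiniteDimensional ℝ (TangentSpace 𝓘(ℝ, E) x) := inferInstanceAs (FiniteDimensional ℝ E)
  have : CompleteSpace (TangentSpace 𝓘(ℝ, E) x) := FiniteDimensional.complete ℝ _
  have h := lintegral_norm_add_average_sub_sq_le hB hunb.1 hunb.2 hvar.1 hvar.2 0
  simpa [batchGrad] using h

variable [IsContMDiffRiemannianBundle 𝓘(ℝ, E) ∞ E (fun x : M ↦ TangentSpace 𝓘(ℝ, E) x)]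
  {L η : ℝ}

/-- On a refresh the error is that of a size-$B$ batch. Otherwise it is $T(g-\nabla f(x))$ plus the
centred average of $\nabla f(y,\xi_i)-T\nabla f(x,\xi_i)$; the first part keeps its norm because $T$
is an isometry, and smoothness bounds each term by $L\eta\|g\|$. -/
theorem lintegral_gradError_pageStep_le (hM : GeodesicallyComplete E M)
    (hunb : ∀ x : M, Integrable (fun ξ ↦ (stochGrad F x ξ : TangentSpace 𝓘(ℝ, E) x)) D ∧
      ∫ ξ, (stochGrad F x ξ : TangentSpace 𝓘(ℝ, E) x) ∂D = grad (objective D F) x)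
    (hvar : ∀ x : M, Integrable (fun ξ ↦ ‖(stochGrad F x ξ : TangentSpace 𝓘(ℝ, E) x)
        - grad (objective D F) x‖ ^ 2) D ∧
      ∫ ξ, ‖(stochGrad F x ξ : TangentSpace 𝓘(ℝ, E) x)
        - grad (objective D F) x‖ ^ 2 ∂D ≤ σ ^ 2)
    (hsmooth : ∀ ξ, GeodesicallySmooth E L (fun x ↦ F x ξ)) (hB : 0 < B) (hb : 0 < b)
    (hη : 0 ≤ η) (p : unitInterval) (z : TangentBundle 𝓘(ℝ, E) M) :
    ∫⁻ s : Sample Ξ B b, ENNReal.ofReal (gradError (objective D F) (pageStep F η z s))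
      ∂(sampleLaw D B b p) ≤
      ENNReal.ofReal (p * (σ ^ 2 / B) + (1 - p) * (gradError (objective D F) z
        + L ^ 2 * η ^ 2 * ‖(z.2 : TangentSpace 𝓘(ℝ, E) z.1)‖ ^ 2 / b)) := by
  obtain ⟨x, g⟩ := z
  have hx : FiniteDimensional ℝ (TangentSpace 𝓘(ℝ, E) x) := inferInstanceAs (FiniteDimensional ℝ E)
  let v : TangentSpace 𝓘(ℝ, E) x := -(η • g)
  set y : M := expMap x v with hy
  have : FiniteDimensional ℝ (TangentSpace 𝓘(ℝ, E) y) := inferInstanceAs (FiniteDimensional ℝ E)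
  have : CompleteSpace (TangentSpace 𝓘(ℝ, E) y) := FiniteDimensional.complete ℝ _
  obtain ⟨T, hT, hTf⟩ := exists_expTransport hM x v
  have hnv : ‖v‖ = η * ‖g‖ := by
    rw [norm_neg, norm_smul, Real.norm_of_nonneg hη]
  let X : Ξ → TangentSpace 𝓘(ℝ, E) y := fun ξ ↦ stochGrad F y ξ - T (stochGrad F x ξ)
  have hTint : Integrable (fun ξ ↦ T (stochGrad F x ξ)) D :=
    T.toContinuousLinearEquiv.toContinuousLinearMap.integrable_comp (hunb x).1
  have hX : Integrable X D := (hunb y).1.sub hTint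
  have hXm : ∫ ξ, X ξ ∂D = grad (objective D F) y - T (grad (objective D F) x) := by
    rw [integral_sub (hunb y).1 hTint, (hunb y).2, ← (hunb x).2]
    congr 1
    exact T.toContinuousLinearEquiv.integral_comp_comm _
  have hXC : ∀ ξ, ‖X ξ‖ ≤ L * (η * ‖g‖) := fun ξ ↦ by
    rw [← hnv]
    exact (hTf L _ (hsmooth ξ)).1
  obtain ⟨hX2, hXv⟩ := integral_norm_sub_sq_le_of_bounded hX hXm hXC
  have hbatch := lintegral_norm_add_average_sub_sq_le hb hX hXm hX2 hXv
    (T (g - grad (objective D F) x))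
  have hite : ∀ s : Sample Ξ B b,
      ENNReal.ofReal (gradError (objective D F) (pageStep F η ⟨x, g⟩ s)) =
      if s.2.2 then
        ENNReal.ofReal (‖(batchGrad F s.1 y : TangentSpace 𝓘(ℝ, E) y)
          - grad (objective D F) y‖ ^ 2)
      else
        ENNReal.ofReal (‖T (g - grad (objective D F) x) + ((1 / b : ℝ) • ∑ i, X (s.2.1 i))
          - (grad (objective D F) y - T (grad (objective D F) x))‖ ^ 2) := by
    rintro ⟨s₁, s₂, c⟩
    cases c
    · have h1 : pageStep F η ⟨x, g⟩ (s₁, s₂, false) = ⟨y, expTransport x v g + batchGrad F s₂ y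
          - expTransport x v (batchGrad F s₂ x)⟩ := rfl
      rw [h1]
      simp only [gradError, Bool.false_eq_true, if_false]
      congr 3
      rw [hT, hT]
      simp only [batchGrad, X, map_smul, map_sum, map_sub, Finset.sum_sub_distrib, smul_sub]
      abel
    · rfl
  simp only [hite]
  refine (lintegral_sampleLaw_ite_le (D := D) p
    (fun ξ : Fin B → Ξ ↦ ENNReal.ofReal (‖(batchGrad F ξ y : TangentSpace 𝓘(ℝ, E) y)
      - grad (objective D F) y‖ ^ 2))
    (fun ξ : Fin b → Ξ ↦ ENNReal.ofReal (‖T (g - grad (objective D F) x)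
      + ((1 / b : ℝ) • ∑ i, X (ξ i))
      - (grad (objective D F) y - T (grad (objective D F) x))‖ ^ 2))).trans ?_
  have hp0 : (0 : ℝ) ≤ p := p.2.1
  have hp1 : (0 : ℝ) ≤ 1 - p := sub_nonneg.2 p.2.2
  rw [ENNReal.ofReal_add (by positivity) (by unfold gradError; positivity),
    ENNReal.ofReal_mul hp0, ENNReal.ofReal_mul hp1]
  gcongr
  · exact lintegral_batchGrad_sub_sq_le (hunb y) (hvar y) hB
  · refine hbatch.trans (le_of_eq ?_)
    congr 1
    rw [LinearIsometryEquiv.norm_map, gradError]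
    ring

/-- The quadratic upper bound at $v=-\eta g$, with the inner product rewritten by polarization:
$2\langle\nabla f,g\rangle=\|\nabla f\|^2+\|g\|^2-\|g-\nabla f\|^2$. -/
theorem objective_pageStep_le {Ξ : Type*} {F : M → Ξ → ℝ} (hM : GeodesicallyComplete E M)
    {f : M → ℝ} (hf : GeodesicallySmooth E L f) (z : TangentBundle 𝓘(ℝ, E) M)
    (s : Sample Ξ B b) :
    f (pageStep F η z s).1 ≤ f z.1 - η / 2 * ‖(grad f z.1 : TangentSpace 𝓘(ℝ, E) z.1)‖ ^ 2
      - (η / 2 - L * η ^ 2 / 2) * ‖(z.2 : TangentSpace 𝓘(ℝ, E) z.1)‖ ^ 2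
      + η / 2 * gradError f z := by
  obtain ⟨x, g⟩ := z
  obtain ⟨T, hT, hTf⟩ := exists_expTransport hM x (-(η • g))
  have h1 : (pageStep F η ⟨x, g⟩ s).1 = expMap x (-(η • g)) := by
    unfold pageStep
    split_ifs <;> rfl
  rw [h1]
  have h2 := (hTf L f hf).2
  rw [norm_neg, norm_smul, mul_pow, Real.norm_eq_abs, sq_abs, inner_neg_right,
    inner_smul_right] at h2
  have h3 : gradError f ⟨x, g⟩ = ‖g‖ ^ 2 - 2 * inner ℝ (grad f x : TangentSpace 𝓘(ℝ, E) x) g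
      + ‖(grad f x : TangentSpace 𝓘(ℝ, E) x)‖ ^ 2 := by
    rw [gradError, norm_sub_sq_real, real_inner_comm]
  rw [h3]
  simp only
  linarith

end OneStep

/-! ### Resampling one coordinate of an i.i.d. sequence -/

section Resampling

/-- Replacing one coordinate of an i.i.d. sequence by an independent copy does not change its
law. -/
theorem map_update_infinitePi_prod {X : Type*} [MeasurableSpace X] (ν : Measure X)
    [IsProbabilityMeasure ν] (j : ℕ) :
    ((Measure.infinitePi fun _ : ℕ ↦ ν).prod ν).map
      (fun q : (ℕ → X) × X ↦ Function.update q.1 j q.2) = Measure.infinitePi fun _ : ℕ ↦ ν := by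
  have hmeas : Measurable (fun q : (ℕ → X) × X ↦ Function.update q.1 j q.2) := by
    refine measurable_pi_lambda _ fun i ↦ ?_
    by_cases hi : i = j
    · subst hi
      simpa using measurable_snd
    · simp only [Function.update_of_ne hi]
      exact (measurable_pi_apply i).comp measurable_fst
  refine Measure.eq_infinitePi _ fun S t ht ↦ ?_
  rw [Measure.map_apply hmeas (MeasurableSet.pi S.countable_toSet fun i _ ↦ ht i)]
  -- The preimage of a box is again a box: the constraint at $j$ moves to the new coordinate and the
  -- old coordinate $j$ becomes free.
  have hpre : (fun q : (ℕ → X) × X ↦ Function.update q.1 j q.2) ⁻¹' ((S : Set ℕ).pi t) =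
      ((S.erase j : Finset ℕ) : Set ℕ).pi t ×ˢ (if j ∈ S then t j else Set.univ) := by
    ext q
    simp only [Set.mem_preimage, Set.mem_pi, Set.mem_prod, Finset.mem_coe, Finset.mem_erase]
    constructor
    · intro h
      refine ⟨fun i hi ↦ by simpa [Function.update_of_ne hi.1] using h i hi.2, ?_⟩
      split_ifs with hj
      · simpa using h j hj
      · trivial
    · rintro ⟨h1, h2⟩ i hi
      by_cases hij : i = j
      · subst hij
        simpa [hi] using h2
      · simpa [Function.update_of_ne hij] using h1 i ⟨hij, hi⟩
  rw [hpre, Measure.prod_prod, Measure.infinitePi_pi _ fun i _ ↦ ht i]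
  split_ifs with hj
  · rw [Finset.prod_erase_mul S (fun i ↦ ν (t i)) hj]
  · rw [Finset.erase_eq_of_notMem hj, measure_univ, mul_one]

end Resampling

/-! ### The potential-function argument -/

section Descent

variable {X : Type*} [MeasurableSpace X] {μ : Measure X}

/-- With $a=\sqrt{(1-p)/(pb)}$ the hypothesis says $aL\eta\le1-L\eta$. Squaring, and using
$(1-L\eta)^2\le1-L\eta$ since $0\le1-L\eta\le1$, gives the form that the potential argument
consumes. -/
theorem pageStepSize_bound {L η p : ℝ} {b : ℕ} (hL : 0 < L) (hη₀ : 0 < η) (hp₀ : 0 < p)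
    (hp₁ : p ≤ 1) (hη : η ≤ 1 / (L * (1 + √((1 - p) / (p * b))))) :
    (1 - p) / (p * b) * (L * η) ^ 2 ≤ 1 - L * η := by
  set a := √((1 - p) / (p * b)) with ha
  have ha0 : 0 ≤ a := Real.sqrt_nonneg _
  have ha2 : (1 - p) / (p * b) = a ^ 2 :=
    (Real.sq_sqrt (div_nonneg (sub_nonneg.2 hp₁) (by positivity))).symm
  have h1 : η * (L * (1 + a)) ≤ 1 := (le_div_iff₀ (by positivity)).1 hη
  have hu : 0 < L * η := by positivity
  have h2 : a * (L * η) ≤ 1 - L * η := by linarith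
  have h3 : 0 ≤ a * (L * η) := by positivity
  calc (1 - p) / (p * b) * (L * η) ^ 2 = (a * (L * η)) ^ 2 := by rw [ha2]; ring
    _ ≤ (1 - L * η) ^ 2 := by gcongr
    _ ≤ 1 - L * η := by nlinarith

/-- The potential-function argument: a descent inequality and a contraction of the estimation
error in mean bound the sum of the mean squared gradient norms. -/
theorem sum_integral_le_of_descent [IsProbabilityMeasure μ] {f e G N : ℕ → X → ℝ}
    {L η p V c₀ c : ℝ} {b : ℕ} (hη₀ : 0 < η) (hp₀ : 0 < p) (hb : 0 < b)
    (hp₁ : p ≤ 1) (hstep : (1 - p) / (p * b) * (L * η) ^ 2 ≤ 1 - L * η)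
    (hfm : ∀ k, Measurable (f k)) (hGm : ∀ k, Measurable (G k)) (hNm : ∀ k, Measurable (N k))
    (hG0 : ∀ k s, 0 ≤ G k s) (hN0 : ∀ k s, 0 ≤ N k s) (he0 : ∀ k s, 0 ≤ e k s)
    (hN : ∀ k s, N k s ≤ 2 * G k s + 2 * e k s) (hc : ∀ k s, c ≤ f k s)
    (hdesc : ∀ k s, f (k + 1) s ≤ f k s - η / 2 * G k s - (η / 2 - L * η ^ 2 / 2) * N k s
      + η / 2 * e k s)
    (hf0 : ∀ s, f 0 s = c₀) (hei : Integrable (e 0) μ) (hev : ∫ s, e 0 s ∂μ ≤ V)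
    (hrec : ∀ k, Integrable (e k) μ → Integrable (N k) μ → Integrable (e (k + 1)) μ ∧
      ∫ s, e (k + 1) s ∂μ ≤
        p * V + (1 - p) * (∫ s, e k s ∂μ + L ^ 2 * η ^ 2 * (∫ s, N k s ∂μ) / b)) (K : ℕ) :
    (∀ k, Integrable (G k) μ) ∧
      η / 2 * ∑ k ∈ Finset.range K, ∫ s, G k s ∂μ ≤
        c₀ - c + η * V / (2 * p) + K * (η * V / 2) := by
  have hb' : (0 : ℝ) < b := by exact_mod_cast hb
  have hu : 0 ≤ 1 - L * η :=
    le_trans (mul_nonneg (div_nonneg (sub_nonneg.2 hp₁) (by positivity)) (sq_nonneg _)) hstep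
  have hα : 0 ≤ η / 2 - L * η ^ 2 / 2 := by
    have := mul_nonneg hη₀.le hu
    linarith
  have hle : ∀ k s, f (k + 1) s ≤ f k s - η / 2 * G k s + η / 2 * e k s := fun k s ↦ by
    have := hdesc k s
    have := mul_nonneg hα (hN0 k s)
    linarith
  -- The lower bound on $f_{k+1}$ turns descent into the domination $G_k\le\frac2\eta(f_k-c)+e_k$.
  have hGint : ∀ k, Integrable (f k) μ → Integrable (e k) μ → Integrable (G k) μ := by
    intro k hfk hek
    refine ((((hfk.sub (integrable_const c)).const_mul (2 / η)).add hek).mono'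
      (hGm k).aestronglyMeasurable) (Filter.Eventually.of_forall fun s ↦ ?_)
    rw [Real.norm_of_nonneg (hG0 k s)]
    have h1 := hle k s
    have h2 := hc (k + 1) s
    have h3 : 2 / η * (η / 2 * G k s) ≤ 2 / η * (f k s - c + η / 2 * e k s) := by
      gcongr
      linarith
    have h4 : 2 / η * (η / 2 * G k s) = G k s := by field_simp
    have h5 : 2 / η * (f k s - c + η / 2 * e k s) = 2 / η * (f k s - c) + e k s := by field_simp
    simpa [h4, h5] using h3
  have hNint : ∀ k, Integrable (f k) μ → Integrable (e k) μ → Integrable (N k) μ := by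
    intro k hfk hek
    refine ((((hGint k hfk hek).const_mul 2).add (hek.const_mul 2)).mono'
      (hNm k).aestronglyMeasurable) (Filter.Eventually.of_forall fun s ↦ ?_)
    rw [Real.norm_of_nonneg (hN0 k s)]
    exact hN k s
  -- Integrability of the two must be propagated together: $f_{k+1}$ lies between $c$ and
  -- $f_k+\frac\eta2e_k$, while integrability of $e_{k+1}$ requires that of $N_k$, which comes from
  -- $f_k$ and $e_k$.
  have hint : ∀ k, Integrable (f k) μ ∧ Integrable (e k) μ := by
    intro k
    induction k with
    | zero => exact ⟨by simp [funext hf0], hei⟩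
    | succ k ih =>
      refine ⟨?_, (hrec k ih.2 (hNint k ih.1 ih.2)).1⟩
      refine integrable_of_le_of_le (hfm (k + 1)).aestronglyMeasurable
        (Filter.Eventually.of_forall (hc (k + 1))) (Filter.Eventually.of_forall fun s ↦ ?_)
        (integrable_const c) (ih.1.add (ih.2.const_mul (η / 2)))
      have := hle k s
      have := mul_nonneg (half_pos hη₀).le (hG0 k s)
      simp only [Pi.add_apply]
      linarith
  have hG : ∀ k, Integrable (G k) μ := fun k ↦ hGint k (hint k).1 (hint k).2
  refine ⟨hG, ?_⟩
  have hNi : ∀ k, Integrable (N k) μ := fun k ↦ hNint k (hint k).1 (hint k).2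
  have hA : ∀ k, ∫ s, f (k + 1) s ∂μ ≤ ∫ s, f k s ∂μ - η / 2 * ∫ s, G k s ∂μ
      - (η / 2 - L * η ^ 2 / 2) * ∫ s, N k s ∂μ + η / 2 * ∫ s, e k s ∂μ := by
    intro k
    have i1 := (hG k).const_mul (η / 2)
    have i2 := (hNi k).const_mul (η / 2 - L * η ^ 2 / 2)
    have i3 := (hint k).2.const_mul (η / 2)
    refine (integral_mono (hint (k + 1)).1 ((((hint k).1.sub i1).sub i2).add i3) (hdesc k)).trans
      (le_of_eq ?_)
    rw [integral_add' (((hint k).1.sub i1).sub i2) i3, integral_sub' ((hint k).1.sub i1) i2,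
      integral_sub' (hint k).1 i1]
    simp only [integral_const_mul]
  -- The weight solves $\frac{\eta}{2p}(1-p)+\frac\eta2=\frac{\eta}{2p}$, so the errors cancel; the
  -- remaining multiple of $\int N_k$ is nonpositive by `hstep`.
  have hΦ : ∀ k, η / 2 * ∫ s, G k s ∂μ ≤ (∫ s, f k s ∂μ + η / (2 * p) * ∫ s, e k s ∂μ)
      - (∫ s, f (k + 1) s ∂μ + η / (2 * p) * ∫ s, e (k + 1) s ∂μ) + η * V / 2 := by
    intro k
    have h1 := hA k
    have h2 := mul_le_mul_of_nonneg_left (hrec k (hint k).2 (hNi k)).2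
      (show 0 ≤ η / (2 * p) by positivity)
    have h3 := mul_le_mul_of_nonneg_left hstep
      (mul_nonneg (half_pos hη₀).le (integral_nonneg (hN0 k) : 0 ≤ ∫ s, N k s ∂μ))
    set n := ∫ s, N k s ∂μ
    set ε := ∫ s, e k s ∂μ
    have h4 : η / (2 * p) * (p * V + (1 - p) * (ε + L ^ 2 * η ^ 2 * n / b)) =
        η * V / 2 + η / (2 * p) * ε - η / 2 * ε
          + η / 2 * n * ((1 - p) / (p * b) * (L * η) ^ 2) := by
      field_simp
      ring
    rw [h4] at h2
    linarith
  have hsum : ∀ K : ℕ, η / 2 * ∑ k ∈ Finset.range K, ∫ s, G k s ∂μ ≤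
      (∫ s, f 0 s ∂μ + η / (2 * p) * ∫ s, e 0 s ∂μ)
      - (∫ s, f K s ∂μ + η / (2 * p) * ∫ s, e K s ∂μ) + K * (η * V / 2) := by
    intro K
    induction K with
    | zero => simp
    | succ K ih =>
      rw [Finset.sum_range_succ, mul_add]
      have := hΦ K
      push_cast
      linarith
  have h0 : ∫ s, f 0 s ∂μ = c₀ := by simp [hf0]
  have hK : c ≤ ∫ s, f K s ∂μ := by
    have := integral_mono (integrable_const c) (hint K).1 (hc K)
    simpa using this
  have heK : 0 ≤ η / (2 * p) * ∫ s, e K s ∂μ :=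
    mul_nonneg (by positivity) (integral_nonneg (he0 K))
  have h0e : η / (2 * p) * ∫ s, e 0 s ∂μ ≤ η * V / (2 * p) := by
    rw [mul_div_right_comm]
    gcongr
  have := hsum K
  rw [h0] at this
  linarith

end Descent

/-! ### Averaging over an independent uniform index -/

section Transfer

/-- Mean of a quantity sampled at a uniform index independent of everything else. -/
theorem integral_comp_uniform_index {X Ω : Type*} [MeasurableSpace X] [MeasurableSpace Ω]
    {P : Measure Ω} [IsProbabilityMeasure P] {μ : Measure X} [IsProbabilityMeasure μ] {K : ℕ}
    {G : ℕ → X → ℝ} (hGm : ∀ k, Measurable (G k)) (hG : ∀ k, Integrable (G k) μ)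
    {κ : Ω → Fin K} {S : Ω → X} (hκ : HasLaw κ (uniformOn Set.univ) P) (hS : HasLaw S μ P)
    (hind : IndepFun κ S P) :
    Integrable (fun a ↦ G (κ a) (S a)) P ∧
      ∫ a, G (κ a) (S a) ∂P = (∑ k ∈ Finset.range K, ∫ s, G k s ∂μ) / K := by
  have hlaw : P.map (fun a ↦ (κ a, S a)) = (uniformOn Set.univ).prod μ := by
    rw [(indepFun_iff_map_prod_eq_prod_map_map hκ.aemeasurable hS.aemeasurable).1 hind,
      hκ.map_eq, hS.map_eq]
  have hpair : AEMeasurable (fun a ↦ (κ a, S a)) P := hκ.aemeasurable.prodMk hS.aemeasurable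
  let H : Fin K × X → ℝ := fun q ↦ G q.1 q.2
  have : IsProbabilityMeasure (uniformOn (Set.univ : Set (Fin K))) := by
    rw [← hκ.map_eq]
    exact Measure.isProbabilityMeasure_map hκ.aemeasurable
  have hH : Measurable H := measurable_from_prod_countable_right fun i ↦ hGm i
  have hHi : Integrable H ((uniformOn Set.univ).prod μ) := by
    rw [integrable_prod_iff hH.aestronglyMeasurable]
    exact ⟨Filter.Eventually.of_forall fun i ↦ hG i, Integrable.of_finite⟩
  rw [← hlaw] at hHi
  refine ⟨(integrable_map_measure hH.aestronglyMeasurable hpair).1 hHi, ?_⟩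
  calc ∫ a, G (κ a) (S a) ∂P = ∫ q, H q ∂(P.map (fun a ↦ (κ a, S a))) :=
        (integral_map hpair hH.aestronglyMeasurable).symm
    _ = ∫ i, ∫ s, H (i, s) ∂μ ∂(uniformOn Set.univ) := by
        rw [hlaw] at hHi ⊢
        exact integral_prod _ hHi
    _ = _ := by
        rw [integral_fintype Integrable.of_finite, Finset.sum_range, Finset.sum_div]
        refine Finset.sum_congr rfl fun i _ ↦ ?_
        rw [measureReal_def, uniformOn_univ]
        simp [H, div_eq_inv_mul]

end Transfer

/-! ### R-PAGE on the canonical space of sample sequences -/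

section Iterates

variable {E : Type*} [NormedAddCommGroup E] [NormedSpace ℝ E] [FiniteDimensional ℝ E]
  {M : Type*} [TopologicalSpace M] [ChartedSpace E M] [IsManifold 𝓘(ℝ, E) ∞ M]
  [RiemannianBundle (fun x : M ↦ TangentSpace 𝓘(ℝ, E) x)]
  {Ξ : Type*} {F : M → Ξ → ℝ} {η : ℝ} {x₀ : M} {B b : ℕ}

/-- The algorithm is non-anticipating: state $k$ reads only samples $0,\dots,k$. -/
theorem pageState_update_of_lt (s : ℕ → Sample Ξ B b) (s' : Sample Ξ B b) {j k : ℕ} (h : k < j) :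
    pageState E F η x₀ (Function.update s j s') k = pageState E F η x₀ s k := by
  induction k with
  | zero => simp only [pageState, Function.update_of_ne h.ne]
  | succ k ih => simp only [pageState, Function.update_of_ne h.ne, ih (by omega)]

theorem pageState_update_succ (s : ℕ → Sample Ξ B b) (s' : Sample Ξ B b) (k : ℕ) :
    pageState E F η x₀ (Function.update s (k + 1) s') (k + 1) =
      pageStep F η (pageState E F η x₀ s k) s' := by
  rw [pageState, pageState_update_of_lt s s' k.lt_succ_self, Function.update_self]

theorem norm_snd_sq_le {E M : Type*} [NormedAddCommGroup E] [NormedSpace ℝ E]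
    [FiniteDimensional ℝ E] [TopologicalSpace M] [ChartedSpace E M]
    [RiemannianBundle (fun x : M ↦ TangentSpace 𝓘(ℝ, E) x)] (f : M → ℝ) (z : TangentBundle 𝓘(ℝ, E) M) :
    ‖(z.2 : TangentSpace 𝓘(ℝ, E) z.1)‖ ^ 2 ≤
      2 * ‖(grad f z.1 : TangentSpace 𝓘(ℝ, E) z.1)‖ ^ 2 + 2 * gradError f z := by
  have h := norm_add_le ((z.2 : TangentSpace 𝓘(ℝ, E) z.1) - grad f z.1) (grad f z.1)
  rw [sub_add_cancel] at h
  rw [gradError]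
  nlinarith [sq_nonneg (‖(z.2 : TangentSpace 𝓘(ℝ, E) z.1) - grad f z.1‖
    - ‖(grad f z.1 : TangentSpace 𝓘(ℝ, E) z.1)‖), norm_nonneg (z.2 : TangentSpace 𝓘(ℝ, E) z.1)]

variable [MeasurableSpace Ξ] {D : Measure Ξ} [IsProbabilityMeasure D] {σ L : ℝ}

theorem lintegral_gradError_pageState_zero_le
    (hunb : Integrable (fun ξ ↦ (stochGrad F x₀ ξ : TangentSpace 𝓘(ℝ, E) x₀)) D ∧
      ∫ ξ, (stochGrad F x₀ ξ : TangentSpace 𝓘(ℝ, E) x₀) ∂D = grad (objective D F) x₀)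
    (hvar : Integrable (fun ξ ↦ ‖(stochGrad F x₀ ξ : TangentSpace 𝓘(ℝ, E) x₀)
        - grad (objective D F) x₀‖ ^ 2) D ∧
      ∫ ξ, ‖(stochGrad F x₀ ξ : TangentSpace 𝓘(ℝ, E) x₀)
        - grad (objective D F) x₀‖ ^ 2 ∂D ≤ σ ^ 2) (hB : 0 < B) (p : unitInterval)
    (hmeas : Measurable (fun s : ℕ → Sample Ξ B b ↦
      gradError (objective D F) (pageState E F η x₀ s 0))) :
    ∫⁻ s, ENNReal.ofReal (gradError (objective D F) (pageState E F η x₀ s 0))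
      ∂(Measure.infinitePi fun _ : ℕ ↦ sampleLaw D B b p) ≤ ENNReal.ofReal (σ ^ 2 / B) := by
  let φ : Sample Ξ B b → ENNReal := fun s' ↦
    ENNReal.ofReal (gradError (objective D F) (pageState E F η x₀ (fun _ ↦ s') 0))
  let ψ : (Fin B → Ξ) → ENNReal := fun ξ ↦ ENNReal.ofReal
    (‖(batchGrad F ξ x₀ : TangentSpace 𝓘(ℝ, E) x₀) - grad (objective D F) x₀‖ ^ 2)
  -- State $0$ reads only sample $0$, so composing with constant sequences yields measurability in
  -- that single sample.
  have hφ : Measurable φ :=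
    (hmeas.comp (measurable_pi_lambda _ fun _ ↦ measurable_id)).ennreal_ofReal
  calc ∫⁻ s, ENNReal.ofReal (gradError (objective D F) (pageState E F η x₀ s 0))
        ∂(Measure.infinitePi fun _ : ℕ ↦ sampleLaw D B b p)
      = ∫⁻ s', φ s' ∂(sampleLaw D B b p) :=
        (measurePreserving_eval_infinitePi (fun _ : ℕ ↦ sampleLaw D B b p) 0).lintegral_comp hφ
    _ = ∫⁻ s', ψ s'.1 ∂(sampleLaw D B b p) := rfl
    _ ≤ ∫⁻ ξ, ∫⁻ _, ψ ξ ∂((Measure.pi fun _ : Fin b ↦ D).prod (bernoulliMeasure true false p))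
        ∂(Measure.pi fun _ ↦ D) := lintegral_prod_le _
    _ = ∫⁻ ξ, ψ ξ ∂(Measure.pi fun _ ↦ D) := by
        simp only [lintegral_const, measure_univ, mul_one]
    _ ≤ ENNReal.ofReal (σ ^ 2 / B) := lintegral_batchGrad_sub_sq_le hunb hvar hB

variable [IsContMDiffRiemannianBundle 𝓘(ℝ, E) ∞ E (fun x : M ↦ TangentSpace 𝓘(ℝ, E) x)]

/-- Resampling coordinate $k+1$ preserves the law and leaves state $k$ fixed, so the inner integral
is the one-step bound at a deterministic state. This takes the place of a conditional expectation
and needs no joint measurability. -/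
theorem lintegral_gradError_pageState_succ_le (hM : GeodesicallyComplete E M)
    (hunb : ∀ x : M, Integrable (fun ξ ↦ (stochGrad F x ξ : TangentSpace 𝓘(ℝ, E) x)) D ∧
      ∫ ξ, (stochGrad F x ξ : TangentSpace 𝓘(ℝ, E) x) ∂D = grad (objective D F) x)
    (hvar : ∀ x : M, Integrable (fun ξ ↦ ‖(stochGrad F x ξ : TangentSpace 𝓘(ℝ, E) x)
        - grad (objective D F) x‖ ^ 2) D ∧
      ∫ ξ, ‖(stochGrad F x ξ : TangentSpace 𝓘(ℝ, E) x)
        - grad (objective D F) x‖ ^ 2 ∂D ≤ σ ^ 2)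
    (hsmooth : ∀ ξ, GeodesicallySmooth E L (fun x ↦ F x ξ)) (hB : 0 < B) (hb : 0 < b)
    (hη : 0 ≤ η) (p : unitInterval) (k : ℕ) :
    ∫⁻ s, ENNReal.ofReal (gradError (objective D F) (pageState E F η x₀ s (k + 1)))
      ∂(Measure.infinitePi fun _ : ℕ ↦ sampleLaw D B b p) ≤
    ∫⁻ s, ENNReal.ofReal (p * (σ ^ 2 / B) +
        (1 - p) * (gradError (objective D F) (pageState E F η x₀ s k) + L ^ 2 * η ^ 2 *
          ‖((pageState E F η x₀ s k).2 : TangentSpace 𝓘(ℝ, E) (pageState E F η x₀ s k).1)‖ ^ 2 / b))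
      ∂(Measure.infinitePi fun _ : ℕ ↦ sampleLaw D B b p) := by
  have hmap := map_update_infinitePi_prod (sampleLaw D B b p) (k + 1)
  calc ∫⁻ s, ENNReal.ofReal (gradError (objective D F) (pageState E F η x₀ s (k + 1)))
        ∂(Measure.infinitePi fun _ : ℕ ↦ sampleLaw D B b p)
      = ∫⁻ s, ENNReal.ofReal (gradError (objective D F) (pageState E F η x₀ s (k + 1)))
        ∂(((Measure.infinitePi fun _ : ℕ ↦ sampleLaw D B b p).prod (sampleLaw D B b p)).map
          fun q ↦ Function.update q.1 (k + 1) q.2) := by rw [hmap]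
    _ ≤ ∫⁻ q : (ℕ → Sample Ξ B b) × Sample Ξ B b, ENNReal.ofReal (gradError (objective D F)
          (pageState E F η x₀ (Function.update q.1 (k + 1) q.2) (k + 1)))
        ∂((Measure.infinitePi fun _ : ℕ ↦ sampleLaw D B b p).prod (sampleLaw D B b p)) :=
        lintegral_map_le _ _
    _ ≤ ∫⁻ s, ∫⁻ s', ENNReal.ofReal (gradError (objective D F)
          (pageState E F η x₀ (Function.update s (k + 1) s') (k + 1)))
        ∂(sampleLaw D B b p) ∂(Measure.infinitePi fun _ : ℕ ↦ sampleLaw D B b p) :=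
        lintegral_prod_le _
    _ ≤ _ := by
        refine lintegral_mono fun s ↦ ?_
        simp only [pageState_update_succ]
        exact lintegral_gradError_pageStep_le hM hunb hvar hsmooth hB hb hη p _

theorem integrable_of_lintegral_ofReal_le {X : Type*} [MeasurableSpace X] {μ : Measure X}
    {e : X → ℝ} (hm : Measurable e) (h0 : ∀ s, 0 ≤ e s) {C : ℝ} (hC : 0 ≤ C)
    (h : ∫⁻ s, ENNReal.ofReal (e s) ∂μ ≤ ENNReal.ofReal C) :
    Integrable e μ ∧ ∫ s, e s ∂μ ≤ C := by
  refine ⟨⟨hm.aestronglyMeasurable, ?_⟩, ?_⟩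
  · rw [hasFiniteIntegral_iff_ofReal (Filter.Eventually.of_forall h0)]
    exact h.trans_lt ENNReal.ofReal_lt_top
  · rw [integral_eq_lintegral_of_nonneg_ae (Filter.Eventually.of_forall h0)
      hm.aestronglyMeasurable]
    exact ENNReal.toReal_le_of_le_ofReal hC h

/-- Convergence of R-PAGE on the canonical space of sample sequences. -/
theorem sum_integral_norm_grad_sq_le [SecondCountableTopology M] (hM : GeodesicallyComplete E M)
    (hf : MDifferentiable 𝓘(ℝ, E) 𝓘(ℝ, ℝ) (objective D F))
    (hunb : ∀ x : M, Integrable (fun ξ ↦ (stochGrad F x ξ : TangentSpace 𝓘(ℝ, E) x)) D ∧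
      ∫ ξ, (stochGrad F x ξ : TangentSpace 𝓘(ℝ, E) x) ∂D = grad (objective D F) x)
    (hvar : ∀ x : M, Integrable (fun ξ ↦ ‖(stochGrad F x ξ : TangentSpace 𝓘(ℝ, E) x)
        - grad (objective D F) x‖ ^ 2) D ∧
      ∫ ξ, ‖(stochGrad F x ξ : TangentSpace 𝓘(ℝ, E) x)
        - grad (objective D F) x‖ ^ 2 ∂D ≤ σ ^ 2)
    (hL : 0 < L) (hsmooth : ∀ ξ, GeodesicallySmooth E L (fun x ↦ F x ξ))
    {fstar : ℝ} (hlow : ∀ x, fstar ≤ objective D F x) (hB : 0 < B) (hb : 0 < b)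
    (p : unitInterval) (hp : 0 < (p : ℝ)) (hη₀ : 0 < η)
    (hη : η ≤ 1 / (L * (1 + √((1 - p) / (p * b)))))
    (hmeas : ∀ k, Measurable[_, borel (TangentBundle 𝓘(ℝ, E) M)]
      (fun s : ℕ → Sample Ξ B b ↦ pageState E F η x₀ s k)) :
    (∀ k, Measurable fun s : ℕ → Sample Ξ B b ↦
      ‖grad (E := E) (objective D F) (pageState E F η x₀ s k).1‖ ^ 2) ∧
    (∀ k, Integrable (fun s : ℕ → Sample Ξ B b ↦
      ‖grad (E := E) (objective D F) (pageState E F η x₀ s k).1‖ ^ 2)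
      (Measure.infinitePi fun _ : ℕ ↦ sampleLaw D B b p)) ∧
    ∀ K : ℕ, η / 2 * ∑ k ∈ Finset.range K, ∫ s,
      ‖grad (E := E) (objective D F) (pageState E F η x₀ s k).1‖ ^ 2
        ∂(Measure.infinitePi fun _ : ℕ ↦ sampleLaw D B b p) ≤
      objective D F x₀ - fstar + η * (σ ^ 2 / B) / (2 * p) + K * (η * (σ ^ 2 / B) / 2) := by
  let : MeasurableSpace (TangentBundle 𝓘(ℝ, E) M) := borel _
  have : BorelSpace (TangentBundle 𝓘(ℝ, E) M) := ⟨rfl⟩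
  let : MeasurableSpace M := borel _
  have : BorelSpace M := ⟨rfl⟩
  have hproj : Continuous (fun z : TangentBundle 𝓘(ℝ, E) M ↦ z.1) :=
    FiberBundle.continuous_proj E (TangentSpace 𝓘(ℝ, E))
  let e : ℕ → (ℕ → Sample Ξ B b) → ℝ := fun k s ↦
    gradError (objective D F) (pageState E F η x₀ s k)
  let N : ℕ → (ℕ → Sample Ξ B b) → ℝ := fun k s ↦
    ‖((pageState E F η x₀ s k).2 : TangentSpace 𝓘(ℝ, E) (pageState E F η x₀ s k).1)‖ ^ 2
  have hGm : ∀ k, Measurable fun s : ℕ → Sample Ξ B b ↦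
      ‖grad (E := E) (objective D F) (pageState E F η x₀ s k).1‖ ^ 2 := fun k ↦
    (measurable_norm_grad_sq hf).comp (hproj.measurable.comp (hmeas k))
  have hem : ∀ k, Measurable (e k) := fun k ↦ (measurable_norm_sub_grad_sq hf).comp (hmeas k)
  have hNm : ∀ k, Measurable (N k) := fun k ↦ continuous_norm_sq_snd.measurable.comp (hmeas k)
  have he0 : ∀ k s, 0 ≤ e k s := fun k s ↦ sq_nonneg _
  have hN0 : ∀ k s, 0 ≤ N k s := fun k s ↦ sq_nonneg _
  have hp1 : (0 : ℝ) ≤ 1 - p := sub_nonneg.2 p.2.2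
  have hzero := integrable_of_lintegral_ofReal_le (hem 0) (he0 0)
    (by positivity : 0 ≤ σ ^ 2 / (B : ℝ))
    (lintegral_gradError_pageState_zero_le (hunb x₀) (hvar x₀) hB p (hem 0))
  have hsum := sum_integral_le_of_descent (e := e) (N := N)
    (μ := Measure.infinitePi fun _ : ℕ ↦ sampleLaw D B b p)
    (f := fun k s ↦ objective D F (pageState E F η x₀ s k).1)
    (G := fun k s ↦ ‖grad (E := E) (objective D F) (pageState E F η x₀ s k).1‖ ^ 2)
    (L := L) (V := σ ^ 2 / B) (c₀ := objective D F x₀) (c := fstar)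
    hη₀ hp hb p.2.2 (pageStepSize_bound hL hη₀ hp p.2.2 hη)
    (fun k ↦ hf.continuous.measurable.comp (hproj.measurable.comp (hmeas k))) hGm hNm
    (fun k s ↦ sq_nonneg _) hN0 he0 (fun k s ↦ norm_snd_sq_le _ _) (fun k s ↦ hlow _)
    (fun k s ↦ objective_pageStep_le hM (GeodesicallySmooth.objective hf hunb hsmooth) _ _)
    (fun s ↦ rfl) hzero.1 hzero.2 (fun k hek hNk ↦ ?_)
  · exact ⟨hGm, (hsum 0).1, fun K ↦ (hsum K).2⟩
  have hNb : Integrable (fun s ↦ L ^ 2 * η ^ 2 * N k s / b)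
      (Measure.infinitePi fun _ : ℕ ↦ sampleLaw D B b p) := (hNk.const_mul _).div_const _
  have hint : Integrable (fun s ↦ (1 - p) * (e k s + L ^ 2 * η ^ 2 * N k s / b))
      (Measure.infinitePi fun _ : ℕ ↦ sampleLaw D B b p) := (hek.add hNb).const_mul _
  have hval : ∫ s, (p * (σ ^ 2 / B) + (1 - p) * (e k s + L ^ 2 * η ^ 2 * N k s / b))
      ∂(Measure.infinitePi fun _ : ℕ ↦ sampleLaw D B b p) = p * (σ ^ 2 / B) + (1 - p) *
      (∫ s, e k s ∂(Measure.infinitePi fun _ : ℕ ↦ sampleLaw D B b p) + L ^ 2 * η ^ 2 *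
        (∫ s, N k s ∂(Measure.infinitePi fun _ : ℕ ↦ sampleLaw D B b p)) / b) := by
    rw [integral_add (integrable_const _) hint, integral_const, integral_const_mul,
      integral_add hek hNb, integral_div, integral_const_mul]
    simp
  have hnn : ∀ s, 0 ≤ p * (σ ^ 2 / B) + (1 - p) * (e k s + L ^ 2 * η ^ 2 * N k s / b) :=
    fun s ↦ by
      have := he0 k s
      have := hN0 k s
      positivity
  -- The bound is folded back into a single integral, so that integrability and the estimate both
  -- follow from one comparison of lower integrals.
  rw [← hval]
  refine integrable_of_lintegral_ofReal_le (hem (k + 1)) (he0 (k + 1)) (integral_nonneg hnn) ?_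
  refine le_of_le_of_eq ?_ (ofReal_integral_eq_lintegral_ofReal
    ((integrable_const _).add hint) (Filter.Eventually.of_forall hnn)).symm
  exact lintegral_gradError_pageState_succ_le hM hunb hvar hsmooth hB hb hη₀.le p k

end Iterates

end RPage

end

/-! ### The convergence theorem -/

theorem theorem4
    -- a complete Riemannian manifold
    {E : Type*} [NormedAddCommGroup E] [NormedSpace ℝ E] [FiniteDimensional ℝ E]
    {M : Type*} [TopologicalSpace M] [T2Space M] [SecondCountableTopology M]
    [ChartedSpace E M] [IsManifold 𝓘(ℝ, E) ∞ M]
    [RiemannianBundle (fun x : M ↦ TangentSpace 𝓘(ℝ, E) x)]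
    [IsContMDiffRiemannianBundle 𝓘(ℝ, E) ∞ E (fun x : M ↦ TangentSpace 𝓘(ℝ, E) x)]
    (hM : RPage.GeodesicallyComplete E M)
    -- the online problem
    {Ξ : Type*} [MeasurableSpace Ξ] (D : Measure Ξ) [IsProbabilityMeasure D]
    (F : M → Ξ → ℝ) (hF : ∀ x, Integrable (F x) D)
    (hf : MDifferentiable 𝓘(ℝ, E) 𝓘(ℝ, ℝ) (RPage.objective D F))
    -- unbiasedness and bounded variance
    (hunb : ∀ x : M, Integrable (fun ξ ↦ (RPage.stochGrad F x ξ : TangentSpace 𝓘(ℝ, E) x)) D ∧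
      ∫ ξ, (RPage.stochGrad F x ξ : TangentSpace 𝓘(ℝ, E) x) ∂D
        = RPage.grad (RPage.objective D F) x)
    (σ : ℝ) (hσ : 0 ≤ σ)
    (hvar : ∀ x : M,
      Integrable (fun ξ ↦ ‖(RPage.stochGrad F x ξ : TangentSpace 𝓘(ℝ, E) x)
        - RPage.grad (RPage.objective D F) x‖ ^ 2) D ∧
      ∫ ξ, ‖(RPage.stochGrad F x ξ : TangentSpace 𝓘(ℝ, E) x)
        - RPage.grad (RPage.objective D F) x‖ ^ 2 ∂D ≤ σ ^ 2)
    -- geodesic smoothness and lower bound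
    (L : ℝ) (hL : 0 < L) (hsmooth : ∀ ξ, RPage.GeodesicallySmooth E L (fun x ↦ F x ξ))
    (fstar : ℝ) (hlow : ∀ x, fstar ≤ RPage.objective D F x)
    -- parameters of the method
    (x₀ : M) (B b K : ℕ) (hB : 0 < B) (hb : 0 < b) (hK : 0 < K)
    (p : ℝ) (hp₀ : 0 < p) (hp₁ : p ≤ 1)
    (η : ℝ) (hη₀ : 0 < η) (hη : η ≤ 1 / (L * (1 + √((1 - p) / (p * b)))))
    -- the iterates are random variables
    (hmeas : ∀ k, Measurable[_, borel (TangentBundle 𝓘(ℝ, E) M)]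
      (fun s : ℕ → RPage.Sample Ξ B b ↦ RPage.pageState E F η x₀ s k))
    -- independent samples, and a uniform output index independent of them
    {Ω : Type*} [MeasurableSpace Ω] (P : Measure Ω) [IsProbabilityMeasure P]
    (S : ℕ → Ω → RPage.Sample Ξ B b)
    (hS : ∀ k, HasLaw (S k) (RPage.sampleLaw D B b ⟨p, hp₀.le, hp₁⟩) P) (hSind : iIndepFun S P)
    (κ : Ω → Fin K) (hκ : HasLaw κ (uniformOn Set.univ) P)
    (hκind : IndepFun κ (fun a k ↦ S k a) P) :
    let xhat : Ω → M := fun a ↦ (RPage.pageState E F η x₀ (fun k ↦ S k a) (κ a)).1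
    let gradSq : Ω → ℝ := fun a ↦
      ‖(RPage.grad (RPage.objective D F) (xhat a) : TangentSpace 𝓘(ℝ, E) (xhat a))‖ ^ 2
    let Φ₀ : ℝ := RPage.objective D F x₀ - fstar + η * σ ^ 2 / (2 * p * B)
    Integrable gradSq P ∧ ∫ a, gradSq a ∂P ≤ 2 * Φ₀ / (η * K) + σ ^ 2 / B := by
  intro xhat gradSq Φ₀
  obtain ⟨hm, hint, hsum⟩ := RPage.sum_integral_norm_grad_sq_le hM hf hunb hvar hL hsmooth hlow
    hB hb ⟨p, hp₀.le, hp₁⟩ hp₀ hη₀ hη hmeas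
  -- Independence and the marginal laws determine the joint law, so the canonical sequence space can
  -- stand in for $\Omega$.
  have hlaw : HasLaw (fun a k ↦ S k a)
      (Measure.infinitePi fun _ : ℕ ↦ RPage.sampleLaw D B b ⟨p, hp₀.le, hp₁⟩) P := by
    refine ⟨aemeasurable_pi_lambda _ fun k ↦ (hS k).aemeasurable, ?_⟩
    rw [(iIndepFun_iff_map_fun_eq_infinitePi_map₀' fun k ↦ (hS k).aemeasurable).1 hSind]
    simp only [(hS _).map_eq]
  obtain ⟨hgi, hgv⟩ := RPage.integral_comp_uniform_index hm hint hκ hlaw hκind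
  refine ⟨hgi, hgv.trans_le ?_⟩
  have hK' : (0 : ℝ) < K := by exact_mod_cast hK
  have hB' : (0 : ℝ) < B := by exact_mod_cast hB
  -- The target is the summed bound multiplied by $2/\eta$ and divided by $K$; the accumulated
  -- $K\eta\sigma^2/(2B)$ becomes exactly $\sigma^2/B$.
  have hrhs : 2 * Φ₀ / (η * K) + σ ^ 2 / B = (2 / η * (RPage.objective D F x₀ - fstar
      + η * (σ ^ 2 / B) / (2 * p) + K * (η * (σ ^ 2 / B) / 2))) / K := by
    simp only [Φ₀]
    field_simp
  rw [hrhs]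
  gcongr
  have h := mul_le_mul_of_nonneg_left (hsum K) (show 0 ≤ 2 / η by positivity)
  rwa [← mul_assoc, show 2 / η * (η / 2) = 1 by field_simp, one_mul] at h
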